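/- **Setting.** Let $1\le r<n$ and $m$ be integers and consider the linear system $$x_{t+1}=Ax_t+Bu_t+w_t,\qquad y_t=Cx_t+\eta_t,\qquad x_0=0,$$ with $A\in\mathbb R^{r\times r}$, $B\in\mathbb R^{r\times m}$, $C\in\mathbb R^{n\times r}$, where $u_t\sim\mathcal N(0,\Sigma_u)$ and $w_t\sim\mathcal N(0,\Sigma_w)$ for $0\le t<T_1$ and $\eta_t\sim\mathcal N(0,\sigma_\eta^2I)$ for $0\le t\le T_1$ are all mutually independent, $\Sigma_u\succ0$, $\Sigma_w\succeq0$ and $\sigma_\eta^2\ge0$. Assume that $(A,B)$ is controllable and $(A,C)$ is observable, and that there are constants $\psi_A\ge1$ and $\rho_A\in(0,1)$ with $\|A^i\|\le\psi_A\rho_A^{i-1}$ for all $i\ge1$. Let $\delta\in(0,1/e)$. Write $\sigma_1(M)\ge\sigma_2(M)\ge\cdots$ for the singular values of a matrix $M$, $\sigma_{\min}(M)$ for the smallest nonzero one, and $\|\cdot\|$ for the operator norm. Put $$\psi_C=\max\{1,\sigma_1(C)\},\quad \psi_\eta=\max\{1,\sigma_\eta^2\},\quad \psi_w=\max\{1,\sigma_1(\Sigma_w+B\Sigma_uB^{\top})\},$$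 $$\phi_C=\min\{1,\sigma_{\min}(C)\},\quad \phi_u=\min\{1,\sigma_{\min}(\Sigma_u)\},\quad \phi_R=\min\{1,\sigma_{\min}([B\ \ AB\ \cdots\ A^{r-1}B])\},$$ $$\kappa_4=\frac{\psi_\eta}{\phi_u\phi_C^2\phi_R^2}\sqrt{\log\tfrac1\delta},\qquad \kappa_5=\Big(\frac{\psi_\eta^2\psi_C^2\psi_w\psi_A^2}{(1-\rho_A^2)\phi_u^2\phi_C^4\phi_R^4}\Big)^2\,\max\Big\{1,\log\Big(\frac{\psi_C^2\psi_w\psi_A^4}{1-\rho_A^2}\,r\log\tfrac r\delta\Big)\Big\}^2\,\log^4\tfrac r\delta .$$ **Algorithm (Col-Approx).** From the observations $y_0,\dots,y_{T_1}$ form $\Sigma_y=\sum_{t=0}^{T_1}y_ty_t^{\top}$. Let $\hat r_c$ be the largest $i\in\{1,\dots,n-1\}$ with $\sigma_i(\Sigma_y)-\sigma_{i+1}(\Sigma_y)>T_1^{3/4}$ (and $0$ if there is none). The output $\widehat\Phi_C\in\mathbb R^{n\times\hat r_c}$ has as columns the first $\hat r_c$ orthonormal eigenvectors of $\Sigma_y$,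 ordered by decreasing eigenvalue. **Lemma 1.** There are absolute constants $c_1,c_2>0$ such that, in this setting, if $$T_1\ \ge\ c_1\,\kappa_5\,n^2r^3,$$ then with probability at least $1-\delta$, for every choice of the eigenvectors in the algorithm, $$\hat r_c=\operatorname{rank}(\widehat\Phi_C)=\operatorname{rank}(C)\qquad\text{and}\qquad \big\|(\widehat\Phi_C^{\perp})^{\top}\Phi_C\big\|\ \le\ c_2\,\kappa_4\sqrt{\frac n{T_1}},$$ where $\Phi_C$ is any matrix whose columns form an orthonormal basis of the column space of $C$ and $\widehat\Phi_C^{\perp}$ is any matrix such that $[\widehat\Phi_C\ \ \widehat\Phi_C^{\perp}]$ is orthogonal. -/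

import Mathlib

open MeasureTheory ProbabilityTheory
open scoped Matrix Matrix.Norms.L2Operator

noncomputable section

namespace ColSpace

/-! ### Singular values (counted from one) -/

/-- `sigma M i` is the `i`-th largest singular value of `M`, for `i ≥ 1`
(Mathlib's sequence of singular values starts at index `0`). -/
def sigma {ι κ : Type*} [Fintype ι] [DecidableEq ι] [Fintype κ] [DecidableEq κ]
    (M : Matrix ι κ ℝ) (i : ℕ) : ℝ :=
  M.toEuclideanLin.singularValues (i - 1)

/-- The smallest nonzero singular value of a nonzero matrix `M`: exactly the first `rank M`
singular values are nonzero. -/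
def sigmaMin {ι κ : Type*} [Fintype ι] [DecidableEq ι] [Fintype κ] [DecidableEq κ]
    (M : Matrix ι κ ℝ) : ℝ :=
  sigma M M.rank

/-! ### Systems and their trajectories -/

/-- A linear system `x_{t+1} = A x_t + B u_t + w_t`, `y_t = C x_t + η_t` with `r` latent states,
`n` observations and `m` inputs, where `w_t ∼ N(0, procCov)` and `η_t ∼ N(0, obsVar • I)`. Both
covariances may be singular. -/
structure LTISystem (r n m : ℕ) where
  A : Matrix (Fin r) (Fin r) ℝ
  B : Matrix (Fin r) (Fin m) ℝ
  C : Matrix (Fin n) (Fin r) ℝ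
  procCov : Matrix (Fin r) (Fin r) ℝ
  obsVar : ℝ
  procCov_posSemidef : procCov.PosSemidef
  obsVar_nonneg : 0 ≤ obsVar

namespace LTISystem

variable {r n m : ℕ} (M : LTISystem r n m)

/-- The covariance `σ_η² I` of the observation noise. -/
def obsCov : Matrix (Fin n) (Fin n) ℝ := M.obsVar • 1

/-- The controllability matrix `[B, AB, …, A^{r-1}B]`. -/
def ctrb : Matrix (Fin r) (Fin r × Fin m) ℝ :=
  Matrix.of fun i p => (M.A ^ (p.1 : ℕ) * M.B) i p.2

/-- The observability matrix with blocks `C, CA, …, CA^{r-1}`. -/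
def obsv : Matrix (Fin r × Fin n) (Fin r) ℝ :=
  Matrix.of fun p j => (M.C * M.A ^ (p.1 : ℕ)) p.2 j

/-- Minimality: `(A, B)` is controllable and `(A, C)` is observable. -/
def IsMinimal : Prop := M.ctrb.rank = r ∧ M.obsv.rank = r

/-- Stability with constants `ψA`, `ρA`: `‖A^i‖ ≤ ψA ρA^{i-1}` for all `i ≥ 1`. -/
def IsStable (ψA ρA : ℝ) : Prop := ∀ i : ℕ, ‖M.A ^ (i + 1)‖ ≤ ψA * ρA ^ i

def psiC : ℝ := max 1 (sigma M.C 1)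

def psiEta : ℝ := max 1 (sigma M.obsCov 1)

/-- `inCov` is the covariance `Σ_u` of the inputs. -/
def psiW (inCov : Matrix (Fin m) (Fin m) ℝ) : ℝ :=
  max 1 (sigma (M.procCov + M.B * inCov * M.Bᵀ) 1)

def phiC : ℝ := min 1 (sigmaMin M.C)

def phiR : ℝ := min 1 (sigmaMin M.ctrb)

end LTISystem

def phiU {m : ℕ} (inCov : Matrix (Fin m) (Fin m) ℝ) : ℝ := min 1 (sigmaMin inCov)

/-- The processes `x`, `y` are generated by the system `M`, started at `x_0 = 0`, from inputs
`u_t ∼ N(0, inCov)` for `t < T`, process noises `w_t ∼ N(0, procCov)` for `t < T` and observation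
noises `η_t ∼ N(0, σ_η² I)` for `t ≤ T`, all of them mutually independent. -/
structure IsTrajectory {r n m : ℕ} (M : LTISystem r n m) (inCov : Matrix (Fin m) (Fin m) ℝ)
    (T : ℕ) {Ω : Type*} [MeasurableSpace Ω] (P : Measure Ω)
    (u : Fin T → Ω → EuclideanSpace ℝ (Fin m)) (w : Fin T → Ω → EuclideanSpace ℝ (Fin r))
    (η : Fin (T + 1) → Ω → EuclideanSpace ℝ (Fin n))
    (x : Fin (T + 1) → Ω → EuclideanSpace ℝ (Fin r))
    (y : Fin (T + 1) → Ω → EuclideanSpace ℝ (Fin n)) : Prop where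
  hasLaw : HasLaw (fun ω => (fun t => u t ω, fun t => w t ω, fun t => η t ω))
    ((Measure.pi fun _ : Fin T => multivariateGaussian 0 inCov).prod
      ((Measure.pi fun _ : Fin T => multivariateGaussian 0 M.procCov).prod
        (Measure.pi fun _ : Fin (T + 1) => multivariateGaussian 0 M.obsCov))) P
  init : ∀ ω, x 0 ω = 0
  step : ∀ (t : Fin T) (ω : Ω), x t.succ ω =
    M.A.toEuclideanLin (x t.castSucc ω) + M.B.toEuclideanLin (u t ω) + w t ω
  obs : ∀ (t : Fin (T + 1)) (ω : Ω), y t ω = M.C.toEuclideanLin (x t ω) + η t ω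

/-! ### Column space approximation -/

variable {n T : ℕ}

/-- The data covariance `Σ_y = ∑_{t=0}^T y_t y_tᵀ`. -/
def dataCov (y : Fin (T + 1) → EuclideanSpace ℝ (Fin n)) : Matrix (Fin n) (Fin n) ℝ :=
  ∑ t, Matrix.vecMulVec (y t).ofLp (y t).ofLp

/-- The rank estimate: the largest `i` in `{1, …, n - 1}` with
`σ_i(Σ_y) - σ_{i+1}(Σ_y) > T^{3/4}` (and `0` if there is none). -/
def rankEst (y : Fin (T + 1) → EuclideanSpace ℝ (Fin n)) : ℕ :=
  sSup {i : ℕ | 1 ≤ i ∧ i < n ∧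
    (T : ℝ) ^ (3 / 4 : ℝ) < sigma (dataCov y) i - sigma (dataCov y) (i + 1)}

/-- `Φhat` is an output of column space approximation on the data `y`: its columns are the first
`rankEst y` orthonormal eigenvectors of `Σ_y`, ordered by decreasing eigenvalue. (`Σ_y` is positive
semidefinite, so its eigenvalues are its singular values; the choice of eigenvectors is free.) -/
def IsColApprox (y : Fin (T + 1) → EuclideanSpace ℝ (Fin n))
    (Φhat : Matrix (Fin n) (Fin (rankEst y)) ℝ) : Prop :=
  Φhatᵀ * Φhat = 1 ∧
    ∀ j, dataCov y *ᵥ Φhat.col j = sigma (dataCov y) ((j : ℕ) + 1) • Φhat.col j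

/-- The columns of `Φ` form an orthonormal basis of the column space of `M`. -/
def IsColBasis {ι κ l : Type*} [Fintype ι] [Fintype κ] [DecidableEq κ] [Fintype l]
    (M : Matrix ι l ℝ) (Φ : Matrix ι κ ℝ) : Prop :=
  Φᵀ * Φ = 1 ∧ Submodule.span ℝ (Set.range Φ.col) = Submodule.span ℝ (Set.range M.col)

/-- `Φperp` is an orthogonal complement of `Φ`: the matrix `[Φ, Φperp]` is unitary. -/
def IsOrthCompl {ι κ l : Type*} [Fintype ι] [DecidableEq ι] [Fintype κ] [DecidableEq κ]
    [Fintype l] [DecidableEq l] (Φ : Matrix ι κ ℝ) (Φperp : Matrix ι l ℝ) : Prop :=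
  (Matrix.fromCols Φ Φperp)ᵀ * Matrix.fromCols Φ Φperp = 1 ∧
    Matrix.fromCols Φ Φperp * (Matrix.fromCols Φ Φperp)ᵀ = 1

/-! ### The problem-related constants -/

/-- `κ₄ = ψ_η / (φ_u φ_C² φ_R²) · √(log (1/δ))`. -/
def kappa4 {r m : ℕ} (M : LTISystem r n m) (inCov : Matrix (Fin m) (Fin m) ℝ) (δ : ℝ) : ℝ :=
  M.psiEta / (phiU inCov * M.phiC ^ 2 * M.phiR ^ 2) * √(Real.log (1 / δ))

/-- `κ₅ = (ψ_η² ψ_C² ψ_w ψ_A² / ((1 - ρ_A²) φ_u² φ_C⁴ φ_R⁴))² · L² · log⁴(r/δ)`, where `L` is the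
maximum of `1` and `log (ψ_C² ψ_w ψ_A⁴ / (1 - ρ_A²) · r log (r/δ))`. -/
def kappa5 {r m : ℕ} (M : LTISystem r n m) (inCov : Matrix (Fin m) (Fin m) ℝ)
    (ψA ρA δ : ℝ) : ℝ :=
  (M.psiEta ^ 2 * M.psiC ^ 2 * M.psiW inCov * ψA ^ 2 /
      ((1 - ρA ^ 2) * phiU inCov ^ 2 * M.phiC ^ 4 * M.phiR ^ 4)) ^ 2 *
    (max 1 (Real.log (M.psiC ^ 2 * M.psiW inCov * ψA ^ 4 / (1 - ρA ^ 2) *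
      ((r : ℝ) * Real.log (r / δ))))) ^ 2 *
    Real.log (r / δ) ^ 4

end ColSpace

end

/-!
Collect the observations in the operator `Y z = (⟪y_t, z⟫)_t`, so that `Σ_y = Y* Y` and
`Y = X C* + N`, where `X` has the latent states as rows and `N` the observation noise.

*Probability.* `X` and `N` are linear images of one Gaussian vector. For a Gaussian family of
vectors `‖L_z ξ‖²` concentrates around its mean at the rate of its weak variance, and a `1/2`-net
of the unit sphere makes this uniform in the direction `z`. The three uses are collected in
`IsTrajectory.exists_event`: the states excite all directions, because after `r` steps every
state has covariance at least `φ_u φ_R²` by controllability, while stability bounds the weak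
variance by a Schur test; the noise satisfies `‖N z‖² ≈ (T + 1) σ_η² ‖z‖²`; and, conditionally on
the states, the projection of `N z` to the `r`-dimensional range of `X` has size
`√(n log (1/δ))` only.

*Linear algebra.* On that event (`IsRegular`), with `τ = (T + 1) σ_η²`, min-max puts all
eigenvalues of `Σ_y` above `τ - O(√T)`, those after the first `rank C` below `τ + O(√T)`, and the
first `rank C` above `τ + c T`; the threshold `T^{3/4}` separates the two scales, so the rank is
found. For the angle, let `W` be the complement of the computed eigenspace and `p ∈ W` with
projection `q` to the column space of `C`. Comparing `⟪Y p, Y q⟫` with `τ ⟪p, q⟫` bounds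
`‖X C* p‖²`, which is at least a multiple of `T ‖q‖²`, by the cross terms and by half of the
(squared) angle itself, so that the bound improves itself
(`IsRegular.abs_inner_le_add_half`). The cross terms are compared with `‖X C* p‖` and not with the
norm of `X`, so that the size of the largest excitation does not enter the rate `κ₄ √(n / T)`, as
it would in a Davis-Kahan bound for `Σ_y`.
-/

namespace ColSpace

open Module
open scoped RealInnerProductSpace NNReal

/-! ### Singular values and quadratic forms -/

section SingularValues

variable {E F : Type*} [NormedAddCommGroup E] [InnerProductSpace ℝ E] [FiniteDimensional ℝ E]
  [NormedAddCommGroup F] [InnerProductSpace ℝ F] [FiniteDimensional ℝ F]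

/-- Right singular vectors: an orthonormal eigenbasis of `T* T`, in the order of the singular
values. -/
lemma exists_orthonormalBasis_adjoint_comp_self (T : E →ₗ[ℝ] F) {n : ℕ} (hn : finrank ℝ E = n) :
    ∃ b : OrthonormalBasis (Fin n) ℝ E,
      ∀ i : Fin n, T.adjoint (T (b i)) = T.singularValues i ^ 2 • b i := by
  refine ⟨T.isSymmetric_adjoint_comp_self.eigenvectorBasis hn, fun i => ?_⟩
  have h := T.isSymmetric_adjoint_comp_self.apply_eigenvectorBasis hn i
  rw [T.sq_singularValues_fin hn i]
  exact h

omit [FiniteDimensional ℝ E] in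
lemma norm_sq_eq_sum_inner_sq {n : ℕ} (b : OrthonormalBasis (Fin n) ℝ E) (x : E) :
    ‖x‖ ^ 2 = ∑ i, ⟪b i, x⟫ ^ 2 :=
  (b.sum_sq_inner_right x).symm

lemma inner_adjoint_apply_self_eq_sum {T : E →ₗ[ℝ] F} {n : ℕ} {b : OrthonormalBasis (Fin n) ℝ E}
    (hb : ∀ i : Fin n, T.adjoint (T (b i)) = T.singularValues i ^ 2 • b i) (i : Fin n) (x : E) :
    ⟪b i, T.adjoint (T x)⟫ = T.singularValues i ^ 2 * ⟪b i, x⟫ := by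
  rw [LinearMap.adjoint_inner_right, ← LinearMap.adjoint_inner_left, hb, real_inner_smul_left]

lemma norm_apply_sq_eq_sum {T : E →ₗ[ℝ] F} {n : ℕ} {b : OrthonormalBasis (Fin n) ℝ E}
    (hb : ∀ i : Fin n, T.adjoint (T (b i)) = T.singularValues i ^ 2 • b i) (x : E) :
    ‖T x‖ ^ 2 = ∑ i : Fin n, T.singularValues i ^ 2 * ⟪b i, x⟫ ^ 2 := by
  rw [← real_inner_self_eq_norm_sq, ← LinearMap.adjoint_inner_right, ← b.sum_inner_mul_inner]
  refine Finset.sum_congr rfl fun i _ => ?_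
  rw [inner_adjoint_apply_self_eq_sum hb, real_inner_comm]
  ring

lemma norm_apply_le_singularValues_zero (T : E →ₗ[ℝ] F) (x : E) :
    ‖T x‖ ≤ T.singularValues 0 * ‖x‖ := by
  obtain ⟨b, hb⟩ := exists_orthonormalBasis_adjoint_comp_self T rfl
  refine le_of_sq_le_sq ?_ (mul_nonneg (T.singularValues_nonneg 0) (norm_nonneg x))
  rw [norm_apply_sq_eq_sum hb, mul_pow, norm_sq_eq_sum_inner_sq b x, Finset.mul_sum]
  gcongr with i
  · exact T.singularValues_nonneg _
  · exact T.singularValues_antitone (Nat.zero_le _)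

/-- On the range of `T`, the adjoint expands by at least the smallest nonzero singular value. -/
lemma singularValues_mul_norm_le_norm_adjoint (T : E →ₗ[ℝ] F) {k : ℕ}
    (hk : k + 1 = finrank ℝ T.range) {z : F} (hz : z ∈ T.range) :
    T.singularValues k * ‖z‖ ≤ ‖T.adjoint z‖ := by
  obtain ⟨a, rfl⟩ := hz
  obtain ⟨b, hb⟩ := exists_orthonormalBasis_adjoint_comp_self T rfl
  refine le_of_sq_le_sq ?_ (norm_nonneg _)
  rw [mul_pow, norm_apply_sq_eq_sum hb, norm_sq_eq_sum_inner_sq b, Finset.mul_sum]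
  refine Finset.sum_le_sum fun i _ => ?_
  rw [inner_adjoint_apply_self_eq_sum hb]
  rcases le_or_gt (i : ℕ) k with h | h
  · have h1 : T.singularValues k ^ 2 ≤ T.singularValues i ^ 2 :=
      pow_le_pow_left₀ (T.singularValues_nonneg _) (T.singularValues_antitone h) 2
    nlinarith [mul_nonneg (sq_nonneg (T.singularValues i)) (sq_nonneg ⟪b i, a⟫)]
  · have h1 : T.singularValues i = 0 := by
      rw [T.singularValues_eq_zero_iff_le_finrank_range]; omega
    simp [h1]

/-- A positive operator is diagonal, with its singular values as eigenvalues, in some orthonormal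
basis. -/
lemma exists_orthonormalBasis_of_isPositive {T : E →ₗ[ℝ] E} (hT : T.IsPositive) {n : ℕ}
    (hn : finrank ℝ E = n) :
    ∃ b : OrthonormalBasis (Fin n) ℝ E, ∀ i : Fin n, T (b i) = T.singularValues i • b i := by
  obtain ⟨b, hb⟩ := exists_orthonormalBasis_adjoint_comp_self T hn
  refine ⟨b, fun i => ?_⟩
  have hadj : T.adjoint = T := hT.isSymmetric.adjoint_eq
  have h2 := hb i
  rw [hadj] at h2
  set s := T.singularValues i with hs
  -- `w = (T - s) bᵢ` satisfies `(T + s) w = 0`, and `T + s` is positive definite unless `s = 0`.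
  set w := T (b i) - s • b i with hw
  have hTw : T w = -(s • w) := by
    rw [hw, map_sub, map_smul, h2]; module
  rcases (T.singularValues_nonneg i).eq_or_lt with h0 | h0
  · have hs0 : s = 0 := h0.symm
    have : ‖T (b i)‖ ^ 2 = 0 := by
      rw [← real_inner_self_eq_norm_sq, ← LinearMap.adjoint_inner_left, hadj, h2, hs0]; simp
    have : T (b i) = 0 := by simpa using this
    rw [this, hs0, zero_smul]
  · have h3 : 0 ≤ ⟪T w, w⟫ := by simpa using hT.re_inner_nonneg_left w
    rw [hTw, inner_neg_left, real_inner_smul_left, real_inner_self_eq_norm_sq] at h3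
    have h4 : ‖w‖ ^ 2 = 0 := by
      have : 0 < s := h0
      nlinarith [sq_nonneg ‖w‖]
    have : w = 0 := by simpa using h4
    exact sub_eq_zero.mp this

lemma inner_apply_self_eq_sum {T : E →ₗ[ℝ] E} {n : ℕ} {b : OrthonormalBasis (Fin n) ℝ E}
    (hb : ∀ i : Fin n, T (b i) = T.singularValues i • b i) (hT : T.IsSymmetric) (x : E) :
    ⟪T x, x⟫ = ∑ i : Fin n, T.singularValues i * ⟪b i, x⟫ ^ 2 := by
  rw [← b.sum_inner_mul_inner]
  refine Finset.sum_congr rfl fun i _ => ?_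
  rw [hT, hb, real_inner_smul_right, real_inner_comm]
  ring

/-- Vectors supported on the coordinates in `s` form a subspace of dimension `|s|`, so they meet
every subspace of dimension larger than `n - |s|`. -/
lemma exists_mem_ne_zero_inner_eq_zero {n : ℕ} (b : OrthonormalBasis (Fin n) ℝ E)
    (s : Finset (Fin n)) (U : Submodule ℝ E) (h : n < finrank ℝ U + s.card) :
    ∃ z ∈ U, z ≠ 0 ∧ ∀ i ∉ s, ⟪b i, z⟫ = 0 := by
  have hE : finrank ℝ E = n := by simpa using finrank_eq_card_basis b.toBasis
  set W : Submodule ℝ E := Submodule.span ℝ (Set.range fun i : s => b i) with hW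
  have hWd : finrank ℝ W = s.card := by
    have hli : LinearIndependent ℝ (fun i : s => b i) :=
      b.orthonormal.linearIndependent.comp _ Subtype.val_injective
    rw [hW, finrank_span_eq_card hli, Fintype.card_coe]
  have hinf := Submodule.finrank_sup_add_finrank_inf_eq U W
  have hsup : finrank ℝ ↥(U ⊔ W) ≤ n := hE ▸ Submodule.finrank_le _
  have hpos : 0 < finrank ℝ ↥(U ⊓ W) := by omega
  obtain ⟨z, hz⟩ := (finrank_pos_iff_exists_ne_zero (R := ℝ)).mp hpos
  refine ⟨z, z.2.1, by simpa using hz, fun i hi => ?_⟩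
  have : W ≤ (ℝ ∙ b i)ᗮ := by
    rw [hW, Submodule.span_le]
    rintro _ ⟨j, rfl⟩
    have hij : i ≠ j := fun h => hi (h ▸ j.2)
    simpa [Submodule.mem_orthogonal_singleton_iff_inner_right] using b.orthonormal.2 hij
  exact Submodule.mem_orthogonal_singleton_iff_inner_right.mp (this z.2.2)

lemma le_singularValues_of_le_inner {T : E →ₗ[ℝ] E} (hT : T.IsPositive) {U : Submodule ℝ E}
    {k : ℕ} (hk : k < finrank ℝ U) {α : ℝ} (h : ∀ z ∈ U, α * ‖z‖ ^ 2 ≤ ⟪T z, z⟫) :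
    α ≤ T.singularValues k := by
  obtain ⟨b, hb⟩ := exists_orthonormalBasis_of_isPositive hT rfl
  have hkn : k < finrank ℝ E := hk.trans_le (Submodule.finrank_le _)
  obtain ⟨z, hzU, hz0, hz⟩ := exists_mem_ne_zero_inner_eq_zero b
    (Finset.univ.filter fun i : Fin (finrank ℝ E) => k ≤ (i : ℕ)) U (by
      have h1 : (Finset.univ.filter fun i : Fin (finrank ℝ E) => k ≤ (i : ℕ)) =
          Finset.Ici ⟨k, hkn⟩ := by ext i; simp [Fin.le_def]
      rw [h1, Fin.card_Ici]
      simp only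
      omega)
  have hle : ⟪T z, z⟫ ≤ T.singularValues k * ‖z‖ ^ 2 := by
    rw [inner_apply_self_eq_sum hb hT.isSymmetric, norm_sq_eq_sum_inner_sq b, Finset.mul_sum]
    refine Finset.sum_le_sum fun i _ => ?_
    rcases le_or_gt k (i : ℕ) with hi | hi
    · gcongr
      exact T.singularValues_antitone hi
    · rw [hz i (by simpa using hi)]; simp
  have hpos : 0 < ‖z‖ ^ 2 := by positivity
  exact le_of_mul_le_mul_right ((h z hzU).trans hle) hpos

lemma singularValues_le_of_inner_le {T : E →ₗ[ℝ] E} (hT : T.IsPositive) {U : Submodule ℝ E}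
    {k : ℕ} (hk : k < finrank ℝ E) (hU : finrank ℝ E ≤ finrank ℝ U + k) {β : ℝ}
    (h : ∀ z ∈ U, ⟪T z, z⟫ ≤ β * ‖z‖ ^ 2) :
    T.singularValues k ≤ β := by
  obtain ⟨b, hb⟩ := exists_orthonormalBasis_of_isPositive hT rfl
  obtain ⟨z, hzU, hz0, hz⟩ := exists_mem_ne_zero_inner_eq_zero b
    (Finset.univ.filter fun i : Fin (finrank ℝ E) => (i : ℕ) ≤ k) U (by
      have h1 : (Finset.univ.filter fun i : Fin (finrank ℝ E) => (i : ℕ) ≤ k) =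
          Finset.Iic ⟨k, hk⟩ := by ext i; simp [Fin.le_def]
      rw [h1, Fin.card_Iic]
      simp only
      omega)
  have hle : T.singularValues k * ‖z‖ ^ 2 ≤ ⟪T z, z⟫ := by
    rw [inner_apply_self_eq_sum hb hT.isSymmetric, norm_sq_eq_sum_inner_sq b, Finset.mul_sum]
    refine Finset.sum_le_sum fun i _ => ?_
    rcases le_or_gt (i : ℕ) k with hi | hi
    · gcongr
      exact T.singularValues_antitone hi
    · rw [hz i (by simpa using hi)]; simp
  have hpos : 0 < ‖z‖ ^ 2 := by positivity
  exact le_of_mul_le_mul_right (hle.trans (h z hzU)) hpos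

/-- If there is a gap after the `k`-th singular value, orthonormal eigenvectors for the first `k`
singular values span the top eigenspace, whichever way they were chosen. -/
lemma inner_apply_self_le_of_orthogonal_top {T : E →ₗ[ℝ] E} (hT : T.IsPositive) {k : ℕ}
    {φ : Fin k → E} (hφ : Orthonormal ℝ φ) (hTφ : ∀ j : Fin k, T (φ j) = T.singularValues j • φ j)
    (hgap : ∀ j : Fin k, T.singularValues k < T.singularValues j) {p : E}
    (hp : ∀ j, ⟪φ j, p⟫ = 0) :
    ⟪T p, p⟫ ≤ T.singularValues k * ‖p‖ ^ 2 := by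
  obtain ⟨b, hb⟩ := exists_orthonormalBasis_of_isPositive hT rfl
  have hkn : k ≤ finrank ℝ E := by
    simpa using hφ.linearIndependent.fintype_card_le_finrank
  -- The `φ j` are orthogonal to the eigenvectors `b i`, `i ≥ k`, whose eigenvalues are smaller.
  have horth : ∀ (i : Fin (finrank ℝ E)) (j : Fin k), k ≤ (i : ℕ) → ⟪b i, φ j⟫ = 0 := by
    intro i j hi
    have h1 : ⟪T (b i), φ j⟫ = ⟪b i, T (φ j)⟫ := hT.isSymmetric _ _
    rw [hb, hTφ, real_inner_smul_left, real_inner_smul_right] at h1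
    have h2 : T.singularValues i ≤ T.singularValues k := T.singularValues_antitone hi
    have h3 := hgap j
    have h4 : (T.singularValues j - T.singularValues i) * ⟪b i, φ j⟫ = 0 := by linarith
    rcases mul_eq_zero.mp h4 with h | h
    · linarith
    · exact h
  set e : Fin k → E := fun j => b ⟨j, j.2.trans_le hkn⟩ with he
  have heo : Orthonormal ℝ e := b.orthonormal.comp _ (fun i j h => by simpa [Fin.ext_iff] using h)
  have hle : Submodule.span ℝ (Set.range φ) ≤ Submodule.span ℝ (Set.range e) := by
    rw [Submodule.span_le]
    rintro _ ⟨j, rfl⟩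
    rw [SetLike.mem_coe, ← b.sum_repr' (φ j)]
    refine Submodule.sum_mem _ fun i _ => ?_
    rcases lt_or_ge (i : ℕ) k with hi | hi
    · exact Submodule.smul_mem _ _ (Submodule.subset_span ⟨⟨i, hi⟩, rfl⟩)
    · rw [horth i j hi, zero_smul]; exact Submodule.zero_mem _
  have heq : Submodule.span ℝ (Set.range φ) = Submodule.span ℝ (Set.range e) :=
    Submodule.eq_of_le_of_finrank_eq hle (by
      rw [finrank_span_eq_card hφ.linearIndependent, finrank_span_eq_card heo.linearIndependent])
  have hpe : ∀ j, ⟪e j, p⟫ = 0 := by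
    have h1 : Submodule.span ℝ (Set.range φ) ≤ (ℝ ∙ p)ᗮ := by
      rw [Submodule.span_le]
      rintro _ ⟨j, rfl⟩
      simpa [Submodule.mem_orthogonal_singleton_iff_inner_left] using hp j
    intro j
    have h2 : e j ∈ Submodule.span ℝ (Set.range φ) := heq ▸ Submodule.subset_span ⟨j, rfl⟩
    exact Submodule.mem_orthogonal_singleton_iff_inner_left.mp (h1 h2)
  rw [inner_apply_self_eq_sum hb hT.isSymmetric, norm_sq_eq_sum_inner_sq b, Finset.mul_sum]
  refine Finset.sum_le_sum fun i _ => ?_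
  rcases lt_or_ge (i : ℕ) k with hi | hi
  · rw [show ⟪b i, p⟫ = 0 from hpe ⟨i, hi⟩]; simp
  · gcongr
    exact T.singularValues_antitone hi

end SingularValues

/-! ### Perturbation of the column space -/

section Perturbation

variable {E F H : Type*} [NormedAddCommGroup E] [InnerProductSpace ℝ E]
  [NormedAddCommGroup F] [InnerProductSpace ℝ F] [NormedAddCommGroup H] [InnerProductSpace ℝ H]

/-- Polarisation: if `‖L z‖² - τ ‖z‖²` is at most `β` for `z = x ± y` with `x`, `y` unit vectors,
then its polar form is at most `β` at `(x, y)`. -/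
lemma abs_inner_sub_le_of_unit (L : E →ₗ[ℝ] H) {τ β : ℝ} {x y : E} (hx : ‖x‖ = 1) (hy : ‖y‖ = 1)
    (hadd : |‖L (x + y)‖ ^ 2 - τ * ‖x + y‖ ^ 2| ≤ β * ‖x + y‖ ^ 2)
    (hsub : |‖L (x - y)‖ ^ 2 - τ * ‖x - y‖ ^ 2| ≤ β * ‖x - y‖ ^ 2) :
    |⟪L x, L y⟫ - τ * ⟪x, y⟫| ≤ β := by
  rw [map_add, norm_add_sq_real, norm_add_sq_real, hx, hy] at hadd
  rw [map_sub, norm_sub_sq_real, norm_sub_sq_real, hx, hy] at hsub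
  rw [abs_le] at *
  constructor <;> nlinarith

/-- A bound on the quadratic form `‖L z‖² - τ ‖z‖²` over a subspace bounds its polar form. -/
lemma abs_inner_sub_le (L : E →ₗ[ℝ] H) {τ β : ℝ} (W : Submodule ℝ E)
    (h : ∀ z ∈ W, |‖L z‖ ^ 2 - τ * ‖z‖ ^ 2| ≤ β * ‖z‖ ^ 2) {x y : E} (hx : x ∈ W) (hy : y ∈ W) :
    |⟪L x, L y⟫ - τ * ⟪x, y⟫| ≤ β * ‖x‖ * ‖y‖ := by
  rcases eq_or_ne x 0 with rfl | hx0
  · simp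
  rcases eq_or_ne y 0 with rfl | hy0
  · simp
  have hnx : 0 < ‖x‖ := norm_pos_iff.mpr hx0
  have hny : 0 < ‖y‖ := norm_pos_iff.mpr hy0
  have hxu : ‖x‖⁻¹ • x ∈ W := W.smul_mem _ hx
  have hyu : ‖y‖⁻¹ • y ∈ W := W.smul_mem _ hy
  have key := abs_inner_sub_le_of_unit L (norm_smul_inv_norm (𝕜 := ℝ) hx0)
    (norm_smul_inv_norm (𝕜 := ℝ) hy0) (h _ (W.add_mem hxu hyu)) (h _ (W.sub_mem hxu hyu))
  simp only [RCLike.ofReal_real_eq_id, id_eq, map_smul, real_inner_smul_left,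
    real_inner_smul_right] at key
  have h1 : ⟪L x, L y⟫ - τ * ⟪x, y⟫ = ‖x‖ * ‖y‖ *
      (‖y‖⁻¹ * (‖x‖⁻¹ * ⟪L x, L y⟫) - τ * (‖y‖⁻¹ * (‖x‖⁻¹ * ⟪x, y⟫))) := by
    field_simp
  rw [h1, abs_mul, abs_of_pos (mul_pos hnx hny)]
  calc _ ≤ ‖x‖ * ‖y‖ * β := by gcongr
    _ = _ := by ring

/-- The regularity of a realisation on which the column space is recovered. The observations are
`Y = X C* + N`, where `X` collects the latent states and `N` the noise: the states excite all
directions of the column space with strength `lam`, the noise is isotropic with level `τ` up to an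
error `e`, and its component along the states is at most `√γ`. The cross term is measured relative
to `‖X v‖`, so that no upper bound on the states is needed. -/
structure IsRegular [FiniteDimensional ℝ E] [FiniteDimensional ℝ F]
    (C : F →ₗ[ℝ] E) (X : F →ₗ[ℝ] H) (N : E →ₗ[ℝ] H) (lam τ e γ : ℝ) : Prop where
  lam_pos : 0 < lam
  e_nonneg : 0 ≤ e
  γ_nonneg : 0 ≤ γ
  signal : ∀ z ∈ C.range, lam * ‖z‖ ^ 2 ≤ ‖X (C.adjoint z)‖ ^ 2
  noise : ∀ z, |‖N z‖ ^ 2 - τ * ‖z‖ ^ 2| ≤ e * ‖z‖ ^ 2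
  cross : ∀ z v, ⟪N z, X v⟫ ^ 2 ≤ γ * ‖z‖ ^ 2 * ‖X v‖ ^ 2

variable [FiniteDimensional ℝ E] [FiniteDimensional ℝ F]
  {C : F →ₗ[ℝ] E} {X : F →ₗ[ℝ] H} {N : E →ₗ[ℝ] H} {lam τ e γ : ℝ}

namespace IsRegular

lemma abs_cross_le (h : IsRegular C X N lam τ e γ) (z : E) (v : F) :
    |⟪N z, X v⟫| ≤ √γ * ‖z‖ * ‖X v‖ := by
  refine abs_le_of_sq_le_sq ?_ (by positivity)
  rw [mul_pow, mul_pow, Real.sq_sqrt h.γ_nonneg]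
  exact h.cross z v

lemma norm_sq_expand (Y : E →ₗ[ℝ] H) (hY : ∀ z, Y z = X (C.adjoint z) + N z) (z : E) :
    ‖Y z‖ ^ 2 = ‖X (C.adjoint z)‖ ^ 2 + 2 * ⟪N z, X (C.adjoint z)⟫ + ‖N z‖ ^ 2 := by
  rw [hY, norm_add_sq_real, real_inner_comm]

variable {Y : E →ₗ[ℝ] H}

lemma le_norm_sq (h : IsRegular C X N lam τ e γ) (hY : ∀ z, Y z = X (C.adjoint z) + N z) (z : E) :
    (τ - e - γ) * ‖z‖ ^ 2 ≤ ‖Y z‖ ^ 2 := by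
  rw [norm_sq_expand Y hY]
  have h1 := abs_le.mp (h.abs_cross_le z (C.adjoint z))
  have h2 := abs_le.mp (h.noise z)
  have h3 := Real.sq_sqrt h.γ_nonneg
  nlinarith [sq_nonneg (‖X (C.adjoint z)‖ - √γ * ‖z‖)]

lemma le_norm_sq_of_mem_range (h : IsRegular C X N lam τ e γ)
    (hY : ∀ z, Y z = X (C.adjoint z) + N z) {z : E} (hz : z ∈ C.range) :
    (lam / 2 - 2 * γ + τ - e) * ‖z‖ ^ 2 ≤ ‖Y z‖ ^ 2 := by
  rw [norm_sq_expand Y hY]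
  have h1 := abs_le.mp (h.abs_cross_le z (C.adjoint z))
  have h2 := abs_le.mp (h.noise z)
  have h3 := Real.sq_sqrt h.γ_nonneg
  have h4 := h.signal z hz
  nlinarith [sq_nonneg (‖X (C.adjoint z)‖ - 2 * √γ * ‖z‖)]

lemma norm_sq_le_of_mem_orthogonal (h : IsRegular C X N lam τ e γ)
    (hY : ∀ z, Y z = X (C.adjoint z) + N z) {z : E} (hz : z ∈ C.rangeᗮ) :
    ‖Y z‖ ^ 2 ≤ (τ + e) * ‖z‖ ^ 2 := by
  have h0 : C.adjoint z = 0 := by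
    rw [LinearMap.orthogonal_range] at hz
    exact hz
  have h2 := abs_le.mp (h.noise z)
  rw [hY, h0, map_zero, zero_add]
  linarith

/-- The self-improving estimate for the angle between the column space `V` of `C` and a subspace
`W` that is invariant under `Y* Y` and carries none of its large eigenvalues. For `p` in `W` with
projection `q` to `V`, compute `⟪(Y* Y - τ) p, q⟫` twice: on `W` the operator is as small as the
noise, and on the other hand the product contains `‖X C* p‖²`. -/
lemma abs_inner_le_add_half (h : IsRegular C X N lam τ e γ)
    (hY : ∀ z, Y z = X (C.adjoint z) + N z) (hsmall : e + γ ≤ lam / 4) {W : Submodule ℝ E}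
    (hW : ∀ p ∈ W, ∀ q ∈ Wᗮ, ⟪Y p, Y q⟫ = 0)
    (hWle : ∀ p ∈ W, ‖Y p‖ ^ 2 ≤ (τ + e) * ‖p‖ ^ 2) {s : ℝ} (hs : 0 ≤ s)
    (hangle : ∀ p ∈ W, ∀ v ∈ C.range, |⟪p, v⟫| ≤ s * ‖p‖ * ‖v‖) {p : E} (hp : p ∈ W) {v : E}
    (hv : v ∈ C.range) :
    |⟪p, v⟫| ≤ (2 * √γ / √lam + e / lam + s / 2) * ‖p‖ * ‖v‖ := by
  have hlam := h.lam_pos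
  have he := h.e_nonneg
  have hγ := h.γ_nonneg
  set q : E := C.range.starProjection p with hq
  have hqV : q ∈ C.range := Submodule.starProjection_apply_mem _ _
  have hpq : p - q ∈ C.rangeᗮ := Submodule.sub_starProjection_mem_orthogonal p
  have hCq : C.adjoint q = C.adjoint p := by
    have : p - q ∈ LinearMap.ker C.adjoint := by rwa [← LinearMap.orthogonal_range]
    rw [LinearMap.mem_ker, map_sub, sub_eq_zero] at this
    exact this.symm
  have hpv : ∀ u ∈ C.range, ⟪p, u⟫ = ⟪q, u⟫ := by
    intro u hu
    have := Submodule.inner_left_of_mem_orthogonal hu hpq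
    rw [inner_sub_left, sub_eq_zero] at this
    exact this
  have hqq : ⟪p, q⟫ = ‖q‖ ^ 2 := by rw [hpv q hqV, real_inner_self_eq_norm_sq]
  set a : ℝ := ‖X (C.adjoint p)‖ with ha
  have ha0 : 0 ≤ a := norm_nonneg _
  have hqp : ‖q‖ ≤ ‖p‖ := Submodule.norm_starProjection_apply_le _ _
  have hqs : ‖q‖ ≤ s * ‖p‖ := by
    have h1 := hangle p hp q hqV
    rw [hqq, abs_of_nonneg (sq_nonneg _)] at h1
    rcases (norm_nonneg q).eq_or_lt with h0 | h0
    · rw [← h0]; positivity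
    · nlinarith
  have hqa : √lam * ‖q‖ ≤ a := by
    refine le_of_sq_le_sq ?_ ha0
    rw [mul_pow, Real.sq_sqrt hlam.le]
    have h1 := h.signal q hqV
    rwa [hCq] at h1
  -- the projection of `q` to `W`
  set w : E := W.starProjection q with hw
  have hwW : w ∈ W := Submodule.starProjection_apply_mem _ _
  have hqw : q - w ∈ Wᗮ := Submodule.sub_starProjection_mem_orthogonal q
  have hwq : ‖w‖ ≤ s * ‖q‖ := by
    have h1 := hangle w hwW q hqV
    have h2 : ⟪w, q⟫ = ‖w‖ ^ 2 := by
      have h3 := Submodule.inner_right_of_mem_orthogonal hwW hqw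
      rw [inner_sub_right, sub_eq_zero, real_inner_self_eq_norm_sq] at h3
      exact h3
    rw [h2, abs_of_nonneg (sq_nonneg _)] at h1
    rcases (norm_nonneg w).eq_or_lt with h0 | h0
    · rw [← h0]; positivity
    · nlinarith
  have hsymm : ∀ z ∈ W, |‖Y z‖ ^ 2 - τ * ‖z‖ ^ 2| ≤ (e + γ) * ‖z‖ ^ 2 := by
    intro z hz
    have h1 := hWle z hz
    have h2 := h.le_norm_sq hY z
    rw [abs_le]
    constructor <;> nlinarith [sq_nonneg ‖z‖]
  have hpol : |⟪Y p, Y w⟫ - τ * ⟪p, w⟫| ≤ (e + γ) * ‖p‖ * ‖w‖ :=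
    abs_inner_sub_le Y W hsymm hp hwW
  have hYq : ⟪Y p, Y q⟫ = ⟪Y p, Y w⟫ := by
    have h1 := hW p hp _ hqw
    rw [map_sub, inner_sub_right, sub_eq_zero] at h1
    exact h1
  have hpw : ⟪p, q⟫ = ⟪p, w⟫ := by
    have h1 := Submodule.inner_right_of_mem_orthogonal hp hqw
    rw [inner_sub_right, sub_eq_zero] at h1
    exact h1
  have hexp : ⟪Y p, Y q⟫ = a ^ 2 + ⟪N q, X (C.adjoint p)⟫ + ⟪N p, X (C.adjoint p)⟫
      + ⟪N p, N q⟫ := by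
    rw [hY, hY, hCq, inner_add_left, inner_add_right, inner_add_right, real_inner_self_eq_norm_sq,
      real_inner_comm (N q) (X _)]
    ring
  have hN : |⟪N p, N q⟫ - τ * ⟪p, q⟫| ≤ e * ‖p‖ * ‖q‖ :=
    abs_inner_sub_le N ⊤ (fun z _ => h.noise z) Submodule.mem_top Submodule.mem_top
  have hc1 := abs_le.mp (h.abs_cross_le q (C.adjoint p))
  have hc2 := abs_le.mp (h.abs_cross_le p (C.adjoint p))
  rw [← ha] at hc1 hc2
  rw [← hpw, ← hYq, hexp] at hpol
  have hpol' := abs_le.mp hpol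
  have hN' := abs_le.mp hN
  set G := √γ with hG
  have hG0 : 0 ≤ G := Real.sqrt_nonneg _
  set S := √lam with hS
  have hS0 : 0 < S := Real.sqrt_pos.mpr hlam
  have hSsq : S ^ 2 = lam := Real.sq_sqrt hlam.le
  have hquad : a ^ 2 ≤ (2 * G + e / S) * ‖p‖ * a + (S / 2 * s * ‖p‖) ^ 2 := by
    have e1 : G * ‖q‖ * a ≤ G * ‖p‖ * a := by gcongr
    have e2 : e * ‖p‖ * ‖q‖ ≤ e / S * ‖p‖ * a := by
      have : ‖q‖ ≤ a / S := by rw [le_div_iff₀ hS0]; linarith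
      calc e * ‖p‖ * ‖q‖ ≤ e * ‖p‖ * (a / S) := by gcongr
        _ = _ := by ring
    have e3 : (e + γ) * ‖p‖ * ‖w‖ ≤ (S / 2 * s * ‖p‖) ^ 2 := by
      calc (e + γ) * ‖p‖ * ‖w‖ ≤ (lam / 4) * ‖p‖ * (s * (s * ‖p‖)) := by
            gcongr
            exact hwq.trans (by gcongr)
        _ = _ := by rw [← hSsq]; ring
    nlinarith
  have hab : a ≤ (2 * G + e / S) * ‖p‖ + S / 2 * s * ‖p‖ := by
    by_contra hcon
    push Not at hcon
    have f1 : 0 ≤ (2 * G + e / S) * ‖p‖ := by positivity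
    have f2 : 0 ≤ S / 2 * s * ‖p‖ := by positivity
    nlinarith
  have hqfin : ‖q‖ ≤ (2 * G / S + e / lam + s / 2) * ‖p‖ := by
    have h1 : ‖q‖ ≤ a / S := by rw [le_div_iff₀ hS0]; linarith
    refine h1.trans ?_
    rw [div_le_iff₀ hS0]
    refine hab.trans (le_of_eq ?_)
    rw [← hSsq]
    field_simp
  rw [hpv v hv]
  calc |⟪q, v⟫| ≤ ‖q‖ * ‖v‖ := abs_real_inner_le_norm _ _
    _ ≤ _ := by gcongr

end IsRegular

end Perturbation

/-! ### Concentration of the squared norm of a Gaussian vector -/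

section Gaussian

/-- Second-order bound on the moment generating function of a centred chi-square variable. -/
lemma inv_sqrt_one_sub_mul_exp_le {y : ℝ} (hy : |y| ≤ 1 / 2) :
    (√(1 - y))⁻¹ * Real.exp (-(y / 2)) ≤ Real.exp (y ^ 2) := by
  have h1 := abs_le.mp hy
  have hpos : 0 < 1 - y := by linarith
  have hlog : -y - 2 * y ^ 2 ≤ Real.log (1 - y) := by
    have h2 := Real.abs_log_sub_add_sum_range_le (x := y) (by linarith : |y| < 1) 1
    have h3 : |y| ^ (1 + 1) / (1 - |y|) ≤ 2 * y ^ 2 := by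
      rw [div_le_iff₀ (by linarith), ← sq_abs y, show 1 + 1 = 2 from rfl]
      nlinarith [mul_nonneg (sq_nonneg |y|) (by linarith : 0 ≤ 1 - 2 * |y|)]
    have h4 := abs_le.mp (h2.trans h3)
    norm_num at h4
    linarith
  have h5 : Real.exp (-(y / 2) - y ^ 2) ≤ √(1 - y) := by
    apply Real.le_sqrt_of_sq_le
    rw [← Real.exp_nat_mul, ← Real.le_log_iff_exp_le hpos]
    push_cast
    linarith
  have hs : 0 < √(1 - y) := Real.sqrt_pos.mpr hpos
  rw [inv_mul_le_iff₀ hs]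
  calc Real.exp (-(y / 2)) = Real.exp (-(y / 2) - y ^ 2) * Real.exp (y ^ 2) := by
        rw [← Real.exp_add]; ring_nf
    _ ≤ _ := by gcongr

lemma integrable_exp_mul_sq_gaussianReal {v : ℝ≥0} {s : ℝ} (hs : 2 * s * v < 1) :
    Integrable (fun x => Real.exp (s * x ^ 2)) (gaussianReal 0 v) := by
  rcases eq_or_ne v 0 with rfl | hv
  · simp [gaussianReal_zero_var, integrable_dirac]
  have hv' : (0 : ℝ) < v := by positivity
  rw [gaussianReal_of_var_ne_zero _ hv,
    integrable_withDensity_iff_integrable_smul' (measurable_gaussianPDF 0 v)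
    (ae_of_all _ fun _ => gaussianPDF_lt_top)]
  have hb : 0 < 1 / (2 * v) - s := by
    rw [sub_pos, lt_div_iff₀ (by positivity)]; linarith
  refine ((integrable_exp_neg_mul_sq hb).const_mul (√(2 * Real.pi * v))⁻¹).congr
    (Filter.Eventually.of_forall fun x => ?_)
  simp only [toReal_gaussianPDF, smul_eq_mul, gaussianPDFReal,
    sub_zero, mul_assoc, ← Real.exp_add]
  congr 3
  ring

lemma integral_exp_mul_sq_gaussianReal {v : ℝ≥0} {s : ℝ} (hs : 2 * s * v < 1) :
    ∫ x, Real.exp (s * x ^ 2) ∂gaussianReal 0 v = (√(1 - 2 * s * v))⁻¹ := by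
  rcases eq_or_ne v 0 with rfl | hv
  · simp [gaussianReal_zero_var]
  have hv' : (0 : ℝ) < v := by positivity
  have hb : 0 < 1 / (2 * v) - s := by
    rw [sub_pos, lt_div_iff₀ (by positivity)]; linarith
  rw [integral_gaussianReal_eq_integral_smul hv]
  have h1 : ∀ x : ℝ, gaussianPDFReal 0 v x • Real.exp (s * x ^ 2) =
      (√(2 * Real.pi * v))⁻¹ * Real.exp (-(1 / (2 * v) - s) * x ^ 2) := by
    intro x
    simp only [smul_eq_mul, gaussianPDFReal, sub_zero, mul_assoc, ← Real.exp_add]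
    congr 2
    ring
  simp_rw [h1]
  rw [integral_const_mul, integral_gaussian, ← Real.sqrt_inv, ← Real.sqrt_inv,
    ← Real.sqrt_mul (by positivity)]
  congr 1
  have : (1 / (2 * v) - s) ≠ 0 := hb.ne'
  have h2 : 1 - 2 * s * v = 2 * v * (1 / (2 * v) - s) := by field_simp
  rw [h2]
  have := Real.pi_pos.ne'
  field_simp

variable {E : Type*} [NormedAddCommGroup E] [InnerProductSpace ℝ E] [FiniteDimensional ℝ E]
  [MeasurableSpace E] [BorelSpace E]

/-- Principal components: a centred Gaussian measure has independent coordinates in an orthonormal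
eigenbasis of its covariance operator. -/
lemma exists_eq_map_pi_gaussianReal (μ : Measure E) [IsGaussian μ] (hμ : μ[id] = 0) :
    ∃ (b : OrthonormalBasis (Fin (finrank ℝ E)) ℝ E) (v : Fin (finrank ℝ E) → ℝ≥0),
      (∀ i, (v i : ℝ) = ∫ x, ⟪b i, x⟫ ^ 2 ∂μ) ∧
      μ = (Measure.pi fun i => gaussianReal 0 (v i)).map (fun x => ∑ i, x i • b i) := by
  have hL2 : MemLp id 2 μ := IsGaussian.memLp_two_id
  have hpos := isPositive_covarianceOperator (μ := μ)
  set S : E →ₗ[ℝ] E := (covarianceOperator μ).toLinearMap with hS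
  have hSs : S.IsSymmetric := hpos.isSymmetric
  set b := hSs.eigenvectorBasis rfl with hb
  have hev : ∀ i, 0 ≤ hSs.eigenvalues rfl i := hpos.nonneg_eigenvalues rfl
  have hcovdef : ∀ x y : E, covarianceBilin μ x y = ⟪S x, y⟫ := by
    intro x y
    have h0 : ∀ z : E, ∫ u, ⟪z, u⟫ ∂μ = 0 := by
      intro z
      have := IsGaussian.integral_dual (μ := μ) (innerSL ℝ z)
      simp only [innerSL_apply_apply] at this
      rw [this]
      have hz : ∫ x, x ∂μ = 0 := by simpa using hμ
      rw [hz, inner_zero_right]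
    rw [covarianceBilin_apply_eq_cov hL2, covariance, hS]
    have := covarianceOperator_inner hL2 x y
    simp only [h0, sub_zero]
    exact this.symm
  have hvar : ∀ x : E, covarianceBilin μ x x = ∫ u, ⟪x, u⟫ ^ 2 ∂μ := by
    intro x
    rw [hcovdef]
    have := covarianceOperator_inner hL2 x x
    rw [hS]
    simp only [pow_two]
    exact this
  have hcov : ∀ t : E, covarianceBilin μ t t = ∑ i, hSs.eigenvalues rfl i * ⟪b i, t⟫ ^ 2 := by
    intro t
    rw [hcovdef, ← b.sum_inner_mul_inner]
    refine Finset.sum_congr rfl fun i _ => ?_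
    rw [hSs, hSs.apply_eigenvectorBasis, RCLike.ofReal_real_eq_id, id_eq, real_inner_smul_right,
      real_inner_comm]
    ring
  refine ⟨b, fun i => (hSs.eigenvalues rfl i).toNNReal, fun i => ?_, ?_⟩
  · rw [← hvar, hcov, Finset.sum_eq_single i]
    · simp only [b.orthonormal.1 i, real_inner_self_eq_norm_sq, one_pow, mul_one]
      exact Real.coe_toNNReal _ (hev i)
    · intro j _ hj
      simp [b.orthonormal.2 hj]
    · simp
  · have : IsProbabilityMeasure ((Measure.pi fun i => gaussianReal 0
        (hSs.eigenvalues rfl i).toNNReal).map (fun x => ∑ i, x i • b i)) :=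
      Measure.isProbabilityMeasure_map (Measurable.aemeasurable (by fun_prop))
    apply Measure.ext_of_charFun
    ext t
    rw [IsGaussian.charFun_eq', hμ, hcov]
    rw [charFun_apply, integral_map (Measurable.aemeasurable (by fun_prop))
      (Measurable.aestronglyMeasurable (by fun_prop))]
    simp_rw [sum_inner, Complex.ofReal_sum, Finset.sum_mul, Complex.exp_sum,
      integral_fintype_prod_eq_prod
        (f := fun i (x : ℝ) => Complex.exp (⟪x • b i, t⟫ * Complex.I)),
      real_inner_smul_left, mul_comm _ (⟪_, _⟫), Complex.ofReal_mul, ← charFun_apply_real,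
      charFun_gaussianReal]
    rw [← Complex.exp_sum]
    congr 1
    simp only [inner_zero_right, Complex.ofReal_zero, zero_mul, mul_zero, zero_sub,
      Finset.sum_neg_distrib, ← Finset.sum_div]
    congr 2
    push_cast
    exact Finset.sum_congr rfl fun i _ => by
      rw [Real.coe_toNNReal _ (hev i)]

/-- The squared norm of a centred Gaussian vector is sub-exponential around its mean. -/
lemma integral_exp_norm_sq_sub_le (μ : Measure E) [IsGaussian μ] (hμ : μ[id] = 0) {Λ : ℝ}
    (hΛ : 0 < Λ) (hvar : ∀ θ : E, ∫ x, ⟪θ, x⟫ ^ 2 ∂μ ≤ Λ * ‖θ‖ ^ 2) {s : ℝ}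
    (hs : |s| ≤ 1 / (4 * Λ)) :
    Integrable (fun x => Real.exp (s * (‖x‖ ^ 2 - ∫ x, ‖x‖ ^ 2 ∂μ))) μ ∧
    ∫ x, Real.exp (s * (‖x‖ ^ 2 - ∫ x, ‖x‖ ^ 2 ∂μ)) ∂μ ≤
      Real.exp (4 * s ^ 2 * Λ * ∫ x, ‖x‖ ^ 2 ∂μ) := by
  obtain ⟨b, v, hv, hmap⟩ := exists_eq_map_pi_gaussianReal μ hμ
  have hvΛ : ∀ i, (v i : ℝ) ≤ Λ := fun i => by
    rw [hv i]
    simpa [b.orthonormal.1 i] using hvar (b i)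
  have hτ : ∫ x, ‖x‖ ^ 2 ∂μ = ∑ i, (v i : ℝ) := by
    simp_rw [← b.sum_sq_inner_right]
    rw [integral_finsetSum]
    · exact Finset.sum_congr rfl fun i _ => (hv i).symm
    · intro i _
      exact ((innerSL ℝ (b i)).comp_memLp' (IsGaussian.memLp_two_id (μ := μ))).integrable_sq
  have hy : ∀ i, |2 * s * v i| ≤ 1 / 2 := fun i => by
    rw [abs_mul, abs_mul, NNReal.abs_eq, abs_two]
    calc 2 * |s| * v i ≤ 2 * (1 / (4 * Λ)) * Λ := by
          gcongr
          exact hvΛ i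
      _ = 1 / 2 := by field_simp; norm_num
  have hlt : ∀ i, 2 * s * v i < 1 := fun i => by
    have := abs_le.mp (hy i); linarith
  have hnorm : ∀ x : Fin (finrank ℝ E) → ℝ, ‖∑ i, x i • b i‖ ^ 2 = ∑ i, x i ^ 2 := by
    intro x
    rw [← b.sum_sq_inner_right]
    refine Finset.sum_congr rfl fun i _ => ?_
    rw [b.orthonormal.inner_right_fintype]
  rw [hτ]
  have hfun : ∀ x : Fin (finrank ℝ E) → ℝ,
      Real.exp (s * (‖∑ i, x i • b i‖ ^ 2 - ∑ i, (v i : ℝ))) =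
        ∏ i, Real.exp (-(2 * s * v i / 2)) * Real.exp (s * x i ^ 2) := by
    intro x
    simp_rw [hnorm, ← Real.exp_add]
    rw [← Real.exp_sum, ← Finset.sum_sub_distrib, Finset.mul_sum]
    congr 1
    exact Finset.sum_congr rfl fun i _ => by ring
  have hmeas : Measurable fun x : Fin (finrank ℝ E) → ℝ => ∑ i, x i • b i := by fun_prop
  have hint : ∀ i, Integrable (fun x => Real.exp (-(2 * s * v i / 2)) * Real.exp (s * x ^ 2))
      (gaussianReal 0 (v i)) := fun i => (integrable_exp_mul_sq_gaussianReal (hlt i)).const_mul _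
  constructor
  · rw [hmap, integrable_map_measure (Measurable.aestronglyMeasurable (by fun_prop))
      hmeas.aemeasurable]
    simp only [Function.comp_def, hfun]
    exact Integrable.fintype_prod_dep hint
  · rw [hmap, integral_map hmeas.aemeasurable (Measurable.aestronglyMeasurable (by fun_prop))]
    simp only [hfun]
    rw [integral_fintype_prod_eq_prod
      (f := fun i x => Real.exp (-(2 * s * v i / 2)) * Real.exp (s * x ^ 2))]
    calc ∏ i, ∫ x, Real.exp (-(2 * s * v i / 2)) * Real.exp (s * x ^ 2) ∂gaussianReal 0 (v i)
        ≤ ∏ i, Real.exp (4 * s ^ 2 * Λ * v i) := by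
          refine Finset.prod_le_prod (fun i _ => integral_nonneg fun x => by positivity)
            fun i _ => ?_
          rw [integral_const_mul, integral_exp_mul_sq_gaussianReal (hlt i), mul_comm]
          refine (inv_sqrt_one_sub_mul_exp_le (hy i)).trans (Real.exp_le_exp.mpr ?_)
          have h1 := hvΛ i
          have h2 : (0 : ℝ) ≤ v i := (v i).2
          have h3 : (v i : ℝ) * v i ≤ Λ * v i := mul_le_mul_of_nonneg_right h1 h2
          calc (2 * s * v i) ^ 2 = 4 * s ^ 2 * (v i * v i) := by ring
            _ ≤ 4 * s ^ 2 * (Λ * v i) := by gcongr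
            _ = _ := by ring
      _ = _ := by rw [← Real.exp_sum, Finset.mul_sum]

/-- Concentration of the squared norm of a centred Gaussian vector whose one-dimensional variances
are at most `Λ`, at scale `Λ p`, where `p` bounds its effective dimension. -/
lemma measureReal_abs_norm_sq_sub_ge_le {Ω : Type*} [MeasurableSpace Ω] {P : Measure Ω}
    {g : Ω → E} (hg : HasGaussianLaw g P) (hg0 : P[g] = 0) {Λ p ε : ℝ}
    (hΛ : 0 < Λ) (hvar : ∀ θ : E, ∫ ω, ⟪θ, g ω⟫ ^ 2 ∂P ≤ Λ * ‖θ‖ ^ 2)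
    (hp : ∫ ω, ‖g ω‖ ^ 2 ∂P ≤ Λ * p) (hε0 : 0 ≤ ε) (hε1 : ε ≤ 1) :
    P.real {ω | ε * (Λ * p) ≤ |‖g ω‖ ^ 2 - ∫ ω, ‖g ω‖ ^ 2 ∂P|} ≤
      2 * Real.exp (-(ε ^ 2 * p / 16)) := by
  have := hg.isProbabilityMeasure
  have hgm := hg.aemeasurable
  have := hg.isGaussian_map
  set μ := P.map g with hμdef
  have hμ0 : μ[id] = 0 := by
    rw [hμdef, integral_map hgm (by fun_prop)]
    exact hg0
  have hvar' : ∀ θ : E, ∫ x, ⟪θ, x⟫ ^ 2 ∂μ ≤ Λ * ‖θ‖ ^ 2 := fun θ => by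
    rw [hμdef, integral_map hgm (Measurable.aestronglyMeasurable (by fun_prop))]
    exact hvar θ
  have hτ : ∫ x, ‖x‖ ^ 2 ∂μ = ∫ ω, ‖g ω‖ ^ 2 ∂P := by
    rw [hμdef, integral_map hgm (Measurable.aestronglyMeasurable (by fun_prop))]
  set τ := ∫ ω, ‖g ω‖ ^ 2 ∂P with hτdef
  set f : Ω → ℝ := fun ω => ‖g ω‖ ^ 2 - τ with hf
  have hmgf : ∀ s : ℝ, |s| ≤ 1 / (4 * Λ) → Integrable (fun ω => Real.exp (s * f ω)) P ∧
      mgf f P s ≤ Real.exp (4 * s ^ 2 * Λ * τ) := by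
    intro s hs
    have h1 := integral_exp_norm_sq_sub_le μ hμ0 hΛ hvar' hs
    rw [hτ, hμdef, integrable_map_measure (Measurable.aestronglyMeasurable (by fun_prop)) hgm,
      integral_map hgm (Measurable.aestronglyMeasurable (by fun_prop))] at h1
    exact h1
  set a : ℝ := ε * (Λ * p) with ha
  set t : ℝ := ε / (8 * Λ) with ht
  have ht0 : 0 ≤ t := by positivity
  have htabs : |t| ≤ 1 / (4 * Λ) := by
    rw [abs_of_nonneg ht0, ht, div_le_div_iff₀ (by positivity) (by positivity)]
    nlinarith
  have hexp : -t * a + 4 * t ^ 2 * Λ * τ ≤ -(ε ^ 2 * p / 16) := by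
    calc -t * a + 4 * t ^ 2 * Λ * τ ≤ -t * a + 4 * t ^ 2 * Λ * (Λ * p) := by gcongr
      _ = _ := by rw [ht, ha]; field_simp; ring
  have hup : P.real {ω | a ≤ f ω} ≤ Real.exp (-(ε ^ 2 * p / 16)) := by
    obtain ⟨h1, h2⟩ := hmgf t htabs
    refine (measure_ge_le_exp_mul_mgf a ht0 h1).trans ?_
    calc Real.exp (-t * a) * mgf f P t ≤ Real.exp (-t * a) * Real.exp (4 * t ^ 2 * Λ * τ) := by
          gcongr
      _ = Real.exp (-t * a + 4 * t ^ 2 * Λ * τ) := (Real.exp_add _ _).symm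
      _ ≤ _ := Real.exp_le_exp.mpr hexp
  have hlow : P.real {ω | f ω ≤ -a} ≤ Real.exp (-(ε ^ 2 * p / 16)) := by
    obtain ⟨h1, h2⟩ := hmgf (-t) (by rwa [abs_neg])
    refine (measure_le_le_exp_mul_mgf (-a) (by linarith) h1).trans ?_
    calc Real.exp (-(-t) * -a) * mgf f P (-t)
        ≤ Real.exp (-(-t) * -a) * Real.exp (4 * (-t) ^ 2 * Λ * τ) := by gcongr
      _ = Real.exp (-t * a + 4 * t ^ 2 * Λ * τ) := by rw [← Real.exp_add]; ring_nf
      _ ≤ _ := Real.exp_le_exp.mpr hexp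
  have hsub : {ω | a ≤ |f ω|} ⊆ {ω | a ≤ f ω} ∪ {ω | f ω ≤ -a} := by
    intro ω hω
    rcases le_abs.mp (show a ≤ |f ω| from hω) with h | h
    · exact Or.inl h
    · exact Or.inr (show f ω ≤ -a by linarith)
  calc P.real {ω | a ≤ |f ω|} ≤ P.real ({ω | a ≤ f ω} ∪ {ω | f ω ≤ -a}) := measureReal_mono hsub
    _ ≤ _ := measureReal_union_le _ _
    _ ≤ _ := by linarith

end Gaussian

/-! ### Nets on the sphere and the union bound -/

section Nets

/-- A `1/2`-net of the unit sphere with at most `5 ^ dim E` points. -/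
lemma exists_finset_net (E : Type*) [NormedAddCommGroup E] [NormedSpace ℝ E]
    [FiniteDimensional ℝ E] :
    ∃ s : Finset E, s.card ≤ 5 ^ finrank ℝ E ∧ (∀ x ∈ s, ‖x‖ = 1) ∧
      ∀ z : E, ‖z‖ = 1 → ∃ x ∈ s, ‖z - x‖ ≤ 1 / 2 := by
  classical
  -- Take a maximal `1`-separated subset of the sphere of radius `2` and halve it.
  let Q : Finset E → Prop := fun s =>
    (∀ x ∈ s, ‖x‖ = 2) ∧ ∀ c ∈ s, ∀ d ∈ s, c ≠ d → 1 ≤ ‖c - d‖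
  let K : Set ℕ := {k | ∃ s, Q s ∧ s.card = k}
  have hbound : ∀ s, Q s → s.card ≤ 5 ^ finrank ℝ E := fun s hs =>
    Besicovitch.card_le_of_separated s (fun c hc => (hs.1 c hc).le) hs.2
  have hK : BddAbove K := ⟨5 ^ finrank ℝ E, by rintro _ ⟨s, hs, rfl⟩; exact hbound s hs⟩
  have hne : K.Nonempty := ⟨0, ∅, ⟨by simp, by simp⟩, rfl⟩
  obtain ⟨s, hs, hcard⟩ : sSup K ∈ K := Nat.sSup_mem hne hK
  refine ⟨s.image fun x => (2⁻¹ : ℝ) • x, Finset.card_image_le.trans (hbound s hs), ?_, ?_⟩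
  · intro x hx
    obtain ⟨y, hy, rfl⟩ := Finset.mem_image.mp hx
    rw [norm_smul, hs.1 y hy]; norm_num
  · intro z hz
    have h2z : ‖(2 : ℝ) • z‖ = 2 := by rw [norm_smul, hz]; norm_num
    obtain ⟨y, hy, hyz⟩ : ∃ y ∈ s, ‖(2 : ℝ) • z - y‖ < 1 := by
      by_contra! hcon
      have hnot : (2 : ℝ) • z ∉ s := fun hmem => by
        have := hcon _ hmem
        norm_num at this
      have hQ : Q (insert ((2 : ℝ) • z) s) := by
        refine ⟨fun x hx => ?_, fun c hc d hd hcd => ?_⟩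
        · rcases Finset.mem_insert.mp hx with rfl | hx
          · exact h2z
          · exact hs.1 x hx
        · rcases Finset.mem_insert.mp hc with rfl | hc
          · rcases Finset.mem_insert.mp hd with rfl | hd
            · exact absurd rfl hcd
            · exact hcon d hd
          · rcases Finset.mem_insert.mp hd with rfl | hd
            · rw [norm_sub_rev]; exact hcon c hc
            · exact hs.2 c hc d hd hcd
      have hle : (insert ((2 : ℝ) • z) s).card ≤ sSup K := le_csSup hK ⟨_, hQ, rfl⟩
      rw [Finset.card_insert_of_notMem hnot] at hle
      omega
    refine ⟨(2⁻¹ : ℝ) • y, Finset.mem_image_of_mem _ hy, ?_⟩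
    have h3 : z - (2⁻¹ : ℝ) • y = (2⁻¹ : ℝ) • ((2 : ℝ) • z - y) := by module
    rw [h3, norm_smul]
    norm_num
    linarith

/-- An operator that is at most `b` on a `1/2`-net of the sphere has norm at most `2 b`. -/
lemma norm_le_two_mul_of_net {E G : Type*} [NormedAddCommGroup E] [NormedSpace ℝ E]
    [NormedAddCommGroup G] [NormedSpace ℝ G] {s : Finset E}
    (hs : ∀ z : E, ‖z‖ = 1 → ∃ x ∈ s, ‖z - x‖ ≤ 1 / 2) (g : E →L[ℝ] G) {b : ℝ} (hb0 : 0 ≤ b)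
    (hb : ∀ x ∈ s, ‖g x‖ ≤ b) : ‖g‖ ≤ 2 * b := by
  have h1 : ‖g‖ ≤ b + ‖g‖ * (1 / 2) := by
    refine g.opNorm_le_of_unit_norm (by positivity) fun z hz => ?_
    obtain ⟨x, hx, hzx⟩ := hs z hz
    calc ‖g z‖ = ‖g x + g (z - x)‖ := by rw [← map_add]; congr 2; abel
      _ ≤ ‖g x‖ + ‖g (z - x)‖ := norm_add_le _ _
      _ ≤ b + ‖g‖ * (1 / 2) := by
          gcongr
          · exact hb x hx
          · exact (g.le_opNorm _).trans (by gcongr)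
  linarith

variable {E H : Type*} [NormedAddCommGroup E] [InnerProductSpace ℝ E] [FiniteDimensional ℝ E]
  [NormedAddCommGroup H] [InnerProductSpace ℝ H] [FiniteDimensional ℝ H]

variable (E) in
/-- Finitely many test vectors control the deviation of `L* L` from a multiple of the identity. -/
lemma exists_finset_test :
    ∃ s : Finset E, s.card ≤ 2 * 25 ^ finrank ℝ E ∧
      ∀ (L : E →ₗ[ℝ] H) (τ β : ℝ), 0 ≤ β →
        (∀ z ∈ s, |‖L z‖ ^ 2 - τ * ‖z‖ ^ 2| ≤ β * ‖z‖ ^ 2) →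
        ∀ z, |‖L z‖ ^ 2 - τ * ‖z‖ ^ 2| ≤ 4 * β * ‖z‖ ^ 2 := by
  classical
  obtain ⟨s, hcard, hunit, hnet⟩ := exists_finset_net E
  have hss : s.card * s.card ≤ 25 ^ finrank ℝ E := by
    calc s.card * s.card ≤ 5 ^ finrank ℝ E * 5 ^ finrank ℝ E := Nat.mul_le_mul hcard hcard
      _ = 25 ^ finrank ℝ E := by rw [← mul_pow]; norm_num
  refine ⟨Finset.image₂ (· + ·) s s ∪ Finset.image₂ (· - ·) s s, ?_, ?_⟩
  · calc _ ≤ (Finset.image₂ (· + ·) s s).card + (Finset.image₂ (· - ·) s s).card :=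
          Finset.card_union_le _ _
      _ ≤ s.card * s.card + s.card * s.card :=
          add_le_add (Finset.card_image₂_le _ _ _) (Finset.card_image₂_le _ _ _)
      _ ≤ _ := by omega
  · intro L τ β hβ h z
    have hpair : ∀ x ∈ s, ∀ y ∈ s, |⟪L x, L y⟫ - τ * ⟪x, y⟫| ≤ β := fun x hx y hy =>
      abs_inner_sub_le_of_unit L (hunit x hx) (hunit y hy)
        (h _ (Finset.mem_union_left _ (Finset.mem_image₂_of_mem hx hy)))
        (h _ (Finset.mem_union_right _ (Finset.mem_image₂_of_mem hx hy)))
    let D : E →L[ℝ] E := (L.adjoint ∘ₗ L - τ • LinearMap.id).toContinuousLinearMap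
    have hD : ∀ x y, ⟪D x, y⟫ = ⟪L x, L y⟫ - τ * ⟪x, y⟫ := by
      intro x y
      simp [D, inner_sub_left, LinearMap.adjoint_inner_left, real_inner_smul_left]
    have h1 : ∀ x ∈ s, ‖D x‖ ≤ 2 * β := by
      intro x hx
      rw [← innerSL_apply_norm ℝ (D x)]
      refine norm_le_two_mul_of_net hnet _ hβ fun y hy => ?_
      rw [innerSL_apply_apply, hD]
      exact hpair x hx y hy
    have h2 : ‖D‖ ≤ 2 * (2 * β) := norm_le_two_mul_of_net hnet D (by positivity) h1
    have h3 : ‖L z‖ ^ 2 - τ * ‖z‖ ^ 2 = ⟪D z, z⟫ := by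
      rw [hD, real_inner_self_eq_norm_sq, real_inner_self_eq_norm_sq]
    rw [h3]
    calc |⟪D z, z⟫| ≤ ‖D z‖ * ‖z‖ := abs_real_inner_le_norm _ _
      _ ≤ (2 * (2 * β) * ‖z‖) * ‖z‖ := by
          gcongr
          exact (D.le_opNorm z).trans (by gcongr)
      _ = _ := by ring

/-- Union bound: a deviation bound for a random quadratic form at each fixed vector holds for all
vectors at once, at the cost of an exponential factor in the dimension. -/
lemma measureReal_exists_abs_sub_gt_le {Ω : Type*} [MeasurableSpace Ω] (P : Measure Ω)
    [IsFiniteMeasure P] (L : Ω → E →ₗ[ℝ] H) {τ β q : ℝ} (hβ : 0 ≤ β) (hq : 0 ≤ q)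
    (h : ∀ z ≠ 0, P.real {ω | β * ‖z‖ ^ 2 ≤ |‖L ω z‖ ^ 2 - τ * ‖z‖ ^ 2|} ≤ q) :
    P.real {ω | ∃ z, 4 * β * ‖z‖ ^ 2 < |‖L ω z‖ ^ 2 - τ * ‖z‖ ^ 2|} ≤
      2 * 25 ^ finrank ℝ E * q := by
  classical
  obtain ⟨s, hcard, hs⟩ := exists_finset_test (H := H) E
  have hsub : {ω | ∃ z, 4 * β * ‖z‖ ^ 2 < |‖L ω z‖ ^ 2 - τ * ‖z‖ ^ 2|} ⊆
      ⋃ z ∈ s.filter (· ≠ 0), {ω | β * ‖z‖ ^ 2 ≤ |‖L ω z‖ ^ 2 - τ * ‖z‖ ^ 2|} := by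
    rintro ω ⟨z, hz⟩
    by_contra hcon
    refine hz.not_ge (hs (L ω) τ β hβ (fun x hx => ?_) z)
    rcases eq_or_ne x 0 with rfl | hx0
    · simp
    · simp only [Set.mem_iUnion, not_exists] at hcon
      exact (not_le.mp (hcon x (Finset.mem_filter.mpr ⟨hx, hx0⟩))).le
  calc _ ≤ _ := measureReal_mono hsub (measure_ne_top _ _)
    _ ≤ ∑ z ∈ s.filter (· ≠ 0), P.real {ω | β * ‖z‖ ^ 2 ≤ |‖L ω z‖ ^ 2 - τ * ‖z‖ ^ 2|} :=
        measureReal_biUnion_finset_le _ _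
    _ ≤ ∑ z ∈ s.filter (· ≠ 0), q :=
        Finset.sum_le_sum fun z hz => h z (Finset.mem_filter.mp hz).2
    _ = (s.filter (· ≠ 0)).card * q := by rw [Finset.sum_const, nsmul_eq_mul]
    _ ≤ 2 * 25 ^ finrank ℝ E * q := by
        gcongr
        exact_mod_cast (Finset.card_filter_le _ _).trans hcard

/-- The union bound relative to a positive definite form `‖B z‖²` instead of `‖z‖²`. -/
lemma measureReal_exists_abs_sub_gt_le' {Ω : Type*} [MeasurableSpace Ω] (P : Measure Ω)
    [IsFiniteMeasure P] (L : Ω → E →ₗ[ℝ] H) (B : E ≃ₗ[ℝ] E) {β q : ℝ} (hβ : 0 ≤ β) (hq : 0 ≤ q)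
    (h : ∀ z ≠ 0, P.real {ω | β * ‖B z‖ ^ 2 ≤ |‖L ω z‖ ^ 2 - ‖B z‖ ^ 2|} ≤ q) :
    P.real {ω | ∃ z, 4 * β * ‖B z‖ ^ 2 < |‖L ω z‖ ^ 2 - ‖B z‖ ^ 2|} ≤
      2 * 25 ^ finrank ℝ E * q := by
  have key := measureReal_exists_abs_sub_gt_le P (fun ω => L ω ∘ₗ B.symm.toLinearMap) (τ := 1)
    hβ hq (fun z hz => by
      have := h (B.symm z) (by simpa using hz)
      simpa using this)
  refine (measureReal_mono ?_).trans key
  rintro ω ⟨z, hz⟩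
  exact ⟨B z, by simpa using hz⟩

end Nets

/-! ### Independent Gaussian noise -/

section Centred

variable {Ω E : Type*} [NormedAddCommGroup Ω] [NormedSpace ℝ Ω] [CompleteSpace Ω]
  [SecondCountableTopology Ω] [MeasurableSpace Ω] [BorelSpace Ω]
  [NormedAddCommGroup E] [InnerProductSpace ℝ E] [FiniteDimensional ℝ E] [MeasurableSpace E]
  [BorelSpace E]

lemma integral_dual_sq_eq_variance (μ : Measure Ω) [IsGaussian μ] (hμ : μ[id] = 0)
    (L : StrongDual ℝ Ω) : ∫ x, L x ^ 2 ∂μ = Var[L; μ] := by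
  rw [variance_of_integral_eq_zero L.continuous.aemeasurable]
  rw [IsGaussian.integral_dual, show ∫ x, x ∂μ = 0 from hμ, map_zero]

omit [CompleteSpace Ω] [SecondCountableTopology Ω] [FiniteDimensional ℝ E] [MeasurableSpace E]
  [BorelSpace E] in
lemma integral_norm_sq_eq_sum {μ : Measure Ω} [IsGaussian μ] {ι : Type*} [Fintype ι]
    (b : OrthonormalBasis ι ℝ E) (A : Ω →L[ℝ] E) :
    ∫ x, ‖A x‖ ^ 2 ∂μ = ∑ i, ∫ x, ⟪b i, A x⟫ ^ 2 ∂μ := by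
  simp_rw [← b.sum_sq_inner_right]
  refine integral_finsetSum _ fun i _ => ?_
  exact (IsGaussian.memLp_dual μ ((innerSL ℝ (b i)).comp A) 2 (by simp)).integrable_sq

/-- Concentration of `‖A x‖²` for a linear image of a centred Gaussian vector `x`. -/
lemma measureReal_abs_norm_sq_apply_sub_ge_le (μ : Measure Ω) [IsGaussian μ] (hμ : μ[id] = 0)
    (A : Ω →L[ℝ] E) {Λ p ε : ℝ} (hΛ : 0 < Λ)
    (hvar : ∀ θ : E, ∫ x, ⟪θ, A x⟫ ^ 2 ∂μ ≤ Λ * ‖θ‖ ^ 2)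
    (hp : ∫ x, ‖A x‖ ^ 2 ∂μ ≤ Λ * p) (hε0 : 0 ≤ ε) (hε1 : ε ≤ 1) :
    μ.real {x | ε * (Λ * p) ≤ |‖A x‖ ^ 2 - ∫ x, ‖A x‖ ^ 2 ∂μ|} ≤
      2 * Real.exp (-(ε ^ 2 * p / 16)) := by
  refine measureReal_abs_norm_sq_sub_ge_le (g := A)
    ((IsGaussian.hasGaussianLaw_id (μ := μ)).map A) ?_ hΛ hvar hp hε0 hε1
  rw [A.integral_comp_comm IsGaussian.integrable_fun_id, show ∫ x, x ∂μ = 0 from hμ, map_zero]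

end Centred

section Product

variable {ι κ : Type*} [Fintype ι] [Fintype κ] [DecidableEq κ]

instance isGaussian_pi_multivariateGaussian (S : Matrix κ κ ℝ) :
    IsGaussian (Measure.pi fun _ : ι => multivariateGaussian 0 S) := by
  have h : HasGaussianLaw (fun (ω : ι → EuclideanSpace ℝ κ) i => ω i)
      (Measure.pi fun _ : ι => multivariateGaussian 0 S) := by
    refine iIndepFun.hasGaussianLaw (fun i => ?_) (iIndepFun_pi (X := fun _ x => x)
      fun i => aemeasurable_id)
    have hmp := measurePreserving_eval (fun _ : ι => multivariateGaussian (0 : EuclideanSpace ℝ κ) S) i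
    exact ⟨by rw [show (fun ω : ι → EuclideanSpace ℝ κ => ω i) = Function.eval i from rfl,
      hmp.map_eq]; infer_instance⟩
  have h2 := h.isGaussian_map
  rwa [show (fun (ω : ι → EuclideanSpace ℝ κ) i => ω i) = id from rfl, Measure.map_id] at h2

lemma integral_id_pi_multivariateGaussian (S : Matrix κ κ ℝ) :
    (Measure.pi fun _ : ι => multivariateGaussian (0 : EuclideanSpace ℝ κ) S)[id] = 0 := by
  ext1 i
  have hmp := measurePreserving_eval (fun _ : ι => multivariateGaussian (0 : EuclideanSpace ℝ κ) S) i
  rw [eval_integral (f := id)]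
  · have h1 := integral_map (μ := Measure.pi fun _ : ι => multivariateGaussian (0 : EuclideanSpace ℝ κ) S)
      hmp.measurable.aemeasurable (f := fun x => x) (by fun_prop)
    rw [hmp.map_eq, integral_id_multivariateGaussian] at h1
    exact h1.symm
  · intro j
    exact (ContinuousLinearMap.proj (R := ℝ) j).integrable_comp
      (IsGaussian.integrable_id (μ := Measure.pi fun _ : ι =>
        multivariateGaussian (0 : EuclideanSpace ℝ κ) S))

lemma inner_toEuclideanLin_eq_dotProduct (S : Matrix κ κ ℝ) (x y : EuclideanSpace ℝ κ) :
    ⟪x, S.toEuclideanLin y⟫ = x.ofLp ⬝ᵥ S *ᵥ y.ofLp := by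
  simp [PiLp.inner_apply, dotProduct, mul_comm]

/-- The linear functional `η ↦ ∑ₛ ⟪cₛ, ηₛ⟫`. -/
noncomputable def sumInner (c : ι → EuclideanSpace ℝ κ) : StrongDual ℝ (ι → EuclideanSpace ℝ κ) :=
  ∑ s, (innerSL ℝ (c s)).comp (ContinuousLinearMap.proj s)

omit [DecidableEq κ] in
@[simp]
lemma sumInner_apply (c η : ι → EuclideanSpace ℝ κ) : sumInner c η = ∑ s, ⟪c s, η s⟫ := by
  simp [sumInner]

lemma variance_sumInner {S : Matrix κ κ ℝ} (hS : S.PosSemidef) (c : ι → EuclideanSpace ℝ κ) :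
    Var[sumInner c; Measure.pi fun _ : ι => multivariateGaussian 0 S] =
      ∑ s, ⟪c s, S.toEuclideanLin (c s)⟫ := by
  have h1 : (sumInner c : (ι → EuclideanSpace ℝ κ) → ℝ) =
      ∑ s, fun η : ι → EuclideanSpace ℝ κ => ⟪c s, η s⟫ := by
    ext η; simp
  rw [h1, variance_sum_pi (X := fun s x => ⟪c s, x⟫)]
  · refine Finset.sum_congr rfl fun s _ => ?_
    rw [inner_toEuclideanLin_eq_dotProduct, ← covarianceBilin_multivariateGaussian (μ := 0) hS,
      covarianceBilin_self IsGaussian.memLp_two_id]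
  · intro s
    exact IsGaussian.memLp_dual _ (innerSL ℝ (c s)) 2 (by simp)

end Product

section Rows

variable {ι E : Type*} [Fintype ι] [NormedAddCommGroup E] [InnerProductSpace ℝ E]
  [FiniteDimensional ℝ E]

/-- The matrix with rows `x t`, as the operator `z ↦ (⟪x t, z⟫)_t`. -/
noncomputable def rowMap (x : ι → E) : E →ₗ[ℝ] EuclideanSpace ℝ ι where
  toFun z := WithLp.toLp 2 fun t => ⟪x t, z⟫
  map_add' z w := by ext t; simp [inner_add_right]
  map_smul' a z := by ext t; simp [real_inner_smul_right]

omit [Fintype ι] [FiniteDimensional ℝ E] in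
@[simp]
lemma rowMap_apply (x : ι → E) (z : E) (t : ι) : rowMap x z t = ⟪x t, z⟫ := rfl

omit [FiniteDimensional ℝ E] in
lemma inner_rowMap (x : ι → E) (θ : EuclideanSpace ℝ ι) (z : E) :
    ⟪θ, rowMap x z⟫ = ∑ t, θ t * ⟪x t, z⟫ := by
  simp [PiLp.inner_apply, mul_comm]

/-- `rowMap x z` is linear in `x`. -/
noncomputable def rowMapAt (z : E) : (ι → E) →L[ℝ] EuclideanSpace ℝ ι :=
  LinearMap.toContinuousLinearMap
    { toFun := fun x => rowMap x z
      map_add' := fun x y => by ext t; simp [inner_add_left]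
      map_smul' := fun a x => by ext t; simp [real_inner_smul_left] }

@[simp]
lemma rowMapAt_apply (z : E) (x : ι → E) : rowMapAt z x = rowMap x z := rfl

end Rows

section Isotropic

variable {ι κ : Type*} [Fintype ι] [Fintype κ] [DecidableEq κ]

/-- The law of independent observation noises `N(0, v I)`. -/
noncomputable abbrev isotropicNoise (ι κ : Type*) [Fintype ι] [Fintype κ] [DecidableEq κ] (v : ℝ) :
    Measure (ι → EuclideanSpace ℝ κ) :=
  Measure.pi fun _ : ι => multivariateGaussian 0 (v • (1 : Matrix κ κ ℝ))

omit [Fintype κ] in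
lemma posSemidef_smul_one {v : ℝ} (hv : 0 ≤ v) : (v • (1 : Matrix κ κ ℝ)).PosSemidef :=
  Matrix.PosSemidef.one.smul hv

lemma integral_inner_rowMap_sq {v : ℝ} (hv : 0 ≤ v) (θ : EuclideanSpace ℝ ι)
    (z : EuclideanSpace ℝ κ) :
    ∫ η, ⟪θ, rowMap η z⟫ ^ 2 ∂(isotropicNoise ι κ v) = v * ‖z‖ ^ 2 * ‖θ‖ ^ 2 := by
  have h1 : ∀ η : ι → EuclideanSpace ℝ κ, ⟪θ, rowMap η z⟫ = sumInner (fun t => θ t • z) η := by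
    intro η
    rw [inner_rowMap, sumInner_apply]
    refine Finset.sum_congr rfl fun t _ => ?_
    rw [real_inner_smul_left, real_inner_comm]
  simp_rw [h1]
  rw [integral_dual_sq_eq_variance _ (integral_id_pi_multivariateGaussian _),
    variance_sumInner (posSemidef_smul_one hv), EuclideanSpace.norm_sq_eq θ, Finset.mul_sum]
  refine Finset.sum_congr rfl fun t _ => ?_
  have h2 : (v • (1 : Matrix κ κ ℝ)).toEuclideanLin (θ t • z) = v • θ t • z := by
    ext i; simp [mul_left_comm]
  rw [h2, real_inner_smul_right, real_inner_self_eq_norm_sq, norm_smul, mul_pow]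
  ring

/-- The noise matrix is nearly isotropic. -/
lemma measureReal_exists_noise_gt_le {v Λ ε : ℝ} (hv : 0 ≤ v) (hvΛ : v ≤ Λ) (hΛ : 0 < Λ)
    (hε0 : 0 ≤ ε) (hε1 : ε ≤ 1) :
    (isotropicNoise ι κ v).real {η | ∃ z, 4 * (ε * (Λ * Fintype.card ι)) * ‖z‖ ^ 2 <
        |‖rowMap η z‖ ^ 2 - Fintype.card ι * v * ‖z‖ ^ 2|} ≤
      2 * 25 ^ Fintype.card κ * (2 * Real.exp (-(ε ^ 2 * Fintype.card ι / 16))) := by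
  have key := measureReal_exists_abs_sub_gt_le (isotropicNoise ι κ v) (fun η => rowMap η)
    (τ := Fintype.card ι * v) (β := ε * (Λ * Fintype.card ι))
    (q := 2 * Real.exp (-(ε ^ 2 * Fintype.card ι / 16))) (by positivity) (by positivity)
    (fun z hz => by
      have hz' : 0 < ‖z‖ ^ 2 := by positivity
      have hmean : ∫ η, ‖rowMapAt z η‖ ^ 2 ∂(isotropicNoise ι κ v) =
          Fintype.card ι * v * ‖z‖ ^ 2 := by
        rw [integral_norm_sq_eq_sum (EuclideanSpace.basisFun ι ℝ)]
        simp only [rowMapAt_apply, integral_inner_rowMap_sq hv, OrthonormalBasis.norm_eq_one]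
        simp [mul_assoc]
      have h1 := measureReal_abs_norm_sq_apply_sub_ge_le (isotropicNoise ι κ v)
        (integral_id_pi_multivariateGaussian _) (rowMapAt z) (Λ := Λ * ‖z‖ ^ 2)
        (p := Fintype.card ι) (ε := ε) (by positivity)
        (fun θ => by
          simp only [rowMapAt_apply, integral_inner_rowMap_sq hv]
          gcongr)
        (by
          rw [hmean]
          calc Fintype.card ι * v * ‖z‖ ^ 2 ≤ Fintype.card ι * Λ * ‖z‖ ^ 2 := by gcongr
            _ = _ := by ring) hε0 hε1
      rw [hmean] at h1
      refine le_trans (le_of_eq ?_) h1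
      congr 1
      ext η
      simp only [Set.mem_ofPred_eq, rowMapAt_apply]
      rw [show ε * (Λ * (Fintype.card ι : ℝ)) * ‖z‖ ^ 2 =
        ε * (Λ * ‖z‖ ^ 2 * (Fintype.card ι : ℝ)) by ring])
  rwa [finrank_euclideanSpace] at key

/-- The noise matrix is nearly orthogonal to every fixed low-dimensional family of rows. -/
lemma measureReal_exists_cross_gt_le {F : Type*} [NormedAddCommGroup F] [InnerProductSpace ℝ F]
    [FiniteDimensional ℝ F] (X : F →ₗ[ℝ] EuclideanSpace ℝ ι) {v Λ p : ℝ} (hv : 0 ≤ v)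
    (hvΛ : v ≤ Λ) (hΛ : 0 < Λ) (hp : (finrank ℝ F : ℝ) ≤ p) :
    (isotropicNoise ι κ v).real
        {η | ∃ z w, 8 * Λ * p * ‖z‖ ^ 2 * ‖X w‖ ^ 2 < ⟪rowMap η z, X w⟫ ^ 2} ≤
      2 * 25 ^ Fintype.card κ * (2 * Real.exp (-(p / 16))) := by
  have hp0 : 0 ≤ p := (Nat.cast_nonneg _).trans hp
  set U : Submodule ℝ (EuclideanSpace ℝ ι) := X.range with hU
  have hUp : (finrank ℝ U : ℝ) ≤ p := le_trans (by exact_mod_cast X.finrank_range_le) hp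
  have key := measureReal_exists_abs_sub_gt_le (isotropicNoise ι κ v)
    (fun η => (U.orthogonalProjectionOnto : _ →ₗ[ℝ] U) ∘ₗ rowMap η) (τ := 0) (β := 2 * (Λ * p))
    (q := 2 * Real.exp (-(p / 16))) (by positivity) (by positivity)
    (fun z hz => by
      have hz' : 0 < ‖z‖ ^ 2 := by positivity
      have hin : ∀ (θ : U) (η : ι → EuclideanSpace ℝ κ),
          ⟪θ, U.orthogonalProjectionOnto (rowMap η z)⟫ = ⟪(θ : EuclideanSpace ℝ ι), rowMap η z⟫ :=
        fun θ η => by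
          rw [Submodule.coe_inner, ← Submodule.starProjection_apply,
            ← Submodule.inner_starProjection_left_eq_right,
            Submodule.starProjection_eq_self_iff.mpr θ.2]
      have hmean : ∫ η, ‖(U.orthogonalProjectionOnto.comp (rowMapAt z)) η‖ ^ 2
          ∂(isotropicNoise ι κ v) = finrank ℝ U * (v * ‖z‖ ^ 2) := by
        rw [integral_norm_sq_eq_sum (stdOrthonormalBasis ℝ U)]
        simp only [ContinuousLinearMap.comp_apply, rowMapAt_apply, hin,
          integral_inner_rowMap_sq hv]
        simp [← Submodule.coe_norm]
      have hle : (finrank ℝ U : ℝ) * (v * ‖z‖ ^ 2) ≤ Λ * ‖z‖ ^ 2 * p := by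
        calc (finrank ℝ U : ℝ) * (v * ‖z‖ ^ 2) ≤ p * (Λ * ‖z‖ ^ 2) := by gcongr
          _ = _ := by ring
      have h1 := measureReal_abs_norm_sq_apply_sub_ge_le (isotropicNoise ι κ v)
        (integral_id_pi_multivariateGaussian _) (U.orthogonalProjectionOnto.comp (rowMapAt z))
        (Λ := Λ * ‖z‖ ^ 2) (p := p) (ε := 1) (by positivity)
        (fun θ => by
          simp only [ContinuousLinearMap.comp_apply, rowMapAt_apply, hin,
            integral_inner_rowMap_sq hv]
          rw [← Submodule.coe_norm]
          gcongr)
        (hmean.trans_le hle) zero_le_one le_rfl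
      rw [hmean] at h1
      refine (measureReal_mono ?_).trans (h1.trans_eq (by norm_num))
      intro η hη
      simp only [Set.mem_ofPred_eq, LinearMap.comp_apply, zero_mul, sub_zero, abs_pow, abs_norm,
        ContinuousLinearMap.coe_coe, ContinuousLinearMap.comp_apply, rowMapAt_apply] at hη ⊢
      rw [one_mul]
      refine le_trans ?_ (le_abs_self _)
      linarith)
  rw [finrank_euclideanSpace] at key
  refine (measureReal_mono ?_).trans key
  rintro η ⟨z, w, h⟩
  refine ⟨z, ?_⟩
  simp only [LinearMap.comp_apply, ContinuousLinearMap.coe_coe, zero_mul, sub_zero, abs_pow,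
    abs_norm]
  have h2 : ⟪rowMap η z, X w⟫ = ⟪U.starProjection (rowMap η z), X w⟫ := by
    rw [Submodule.inner_starProjection_left_eq_right,
      Submodule.starProjection_eq_self_iff.mpr (LinearMap.mem_range_self X w)]
  have h3 : ⟪rowMap η z, X w⟫ ^ 2 ≤ ‖U.orthogonalProjectionOnto (rowMap η z)‖ ^ 2 * ‖X w‖ ^ 2 := by
    rw [h2, ← mul_pow, ← sq_abs]
    gcongr
    exact abs_real_inner_le_norm _ _
  have h4 := h.trans_le h3
  have h5 := lt_of_mul_lt_mul_right h4 (sq_nonneg _)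
  linarith

end Isotropic

/-! ### Excitation and mixing of the latent states -/

section LinearAlgebra

variable {ι κ : Type*} [Fintype ι] [DecidableEq ι] [Fintype κ] [DecidableEq κ]

lemma adjoint_toEuclideanLin (K : Matrix ι κ ℝ) :
    LinearMap.adjoint K.toEuclideanLin = Kᵀ.toEuclideanLin := by
  rw [← Matrix.conjTranspose_eq_transpose_of_trivial, Matrix.toEuclideanLin_conjTranspose_eq_adjoint]

lemma inner_toEuclideanLin_right (K : Matrix ι κ ℝ) (x : EuclideanSpace ℝ ι)
    (y : EuclideanSpace ℝ κ) : ⟪x, K.toEuclideanLin y⟫ = ⟪Kᵀ.toEuclideanLin x, y⟫ := by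
  rw [← adjoint_toEuclideanLin, LinearMap.adjoint_inner_left]

omit [Fintype ι] [DecidableEq ι] in
lemma toEuclideanLin_mul_apply {l : Type*} [Fintype l] [DecidableEq l] (K : Matrix ι κ ℝ)
    (N : Matrix κ l ℝ) (x : EuclideanSpace ℝ l) :
    (K * N).toEuclideanLin x = K.toEuclideanLin (N.toEuclideanLin x) := by
  ext i; simp

omit [DecidableEq ι] in
lemma norm_toEuclideanLin_le (K : Matrix ι κ ℝ) (x : EuclideanSpace ℝ κ) :
    ‖K.toEuclideanLin x‖ ≤ ‖K‖ * ‖x‖ := by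
  rw [Matrix.l2_opNorm_def]
  exact ContinuousLinearMap.le_opNorm (LinearMap.toContinuousLinearMap K.toEuclideanLin) x

lemma norm_transpose (K : Matrix ι κ ℝ) : ‖Kᵀ‖ = ‖K‖ := by
  rw [← Matrix.conjTranspose_eq_transpose_of_trivial, Matrix.l2_opNorm_conjTranspose]

omit [DecidableEq ι] in
lemma finrank_range_toEuclideanLin (K : Matrix ι κ ℝ) :
    finrank ℝ (LinearMap.range K.toEuclideanLin) = K.rank := by
  rw [Matrix.toEuclideanLin_eq_toLin_orthonormal]
  exact (K.rank_eq_finrank_range_toLin _ _).symm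

lemma norm_toEuclideanLin_le_sigma_one (K : Matrix ι κ ℝ) (x : EuclideanSpace ℝ κ) :
    ‖K.toEuclideanLin x‖ ≤ sigma K 1 * ‖x‖ :=
  norm_apply_le_singularValues_zero _ x

lemma sigmaMin_pos {K : Matrix ι κ ℝ} (hK : 0 < K.rank) : 0 < sigmaMin K := by
  rw [sigmaMin, sigma, LinearMap.singularValues_pos_iff_lt_finrank_range,
    finrank_range_toEuclideanLin]
  omega

lemma sigmaMin_nonneg (K : Matrix ι κ ℝ) : 0 ≤ sigmaMin K :=
  LinearMap.singularValues_nonneg _ _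

lemma sigmaMin_mul_norm_le {K : Matrix ι κ ℝ} (hK : 0 < K.rank) {z : EuclideanSpace ℝ ι}
    (hz : z ∈ LinearMap.range K.toEuclideanLin) :
    sigmaMin K * ‖z‖ ≤ ‖Kᵀ.toEuclideanLin z‖ := by
  rw [← adjoint_toEuclideanLin]
  refine singularValues_mul_norm_le_norm_adjoint _ ?_ hz
  rw [finrank_range_toEuclideanLin]
  omega

/-- A positive definite operator is a square `B* B` with `B` invertible. -/
lemma exists_linearEquiv_norm_sq_eq {E : Type*} [NormedAddCommGroup E] [InnerProductSpace ℝ E]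
    [FiniteDimensional ℝ E] {S : E →ₗ[ℝ] E} (hS : S.IsPositive)
    (hpos : ∀ v ≠ 0, 0 < ⟪S v, v⟫) :
    ∃ B : E ≃ₗ[ℝ] E, ∀ v, ‖B v‖ ^ 2 = ⟪S v, v⟫ := by
  obtain ⟨b, hb⟩ := exists_orthonormalBasis_of_isPositive hS rfl
  let B : E →ₗ[ℝ] E :=
    ∑ i : Fin (finrank ℝ E), ((innerₗ E (b i)).smulRight (√(S.singularValues i) • b i))
  have hB : ∀ v, B v = ∑ i, (⟪b i, v⟫ * √(S.singularValues i)) • b i := by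
    intro v; simp [B, smul_smul]
  have hnorm : ∀ v, ‖B v‖ ^ 2 = ⟪S v, v⟫ := by
    intro v
    rw [← b.sum_sq_inner_right, inner_apply_self_eq_sum hb hS.isSymmetric]
    refine Finset.sum_congr rfl fun i _ => ?_
    rw [hB, b.orthonormal.inner_right_fintype, mul_pow, Real.sq_sqrt (S.singularValues_nonneg _)]
    ring
  have hinj : Function.Injective B := by
    rw [injective_iff_map_eq_zero]
    intro v hv
    by_contra hne
    have h1 := hpos v hne
    rw [← hnorm, hv] at h1
    simp at h1
  exact ⟨LinearEquiv.ofInjectiveEndo B hinj, hnorm⟩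

omit [DecidableEq ι] [DecidableEq κ] in
/-- **Schur test**, in the special case of a nonnegative kernel. -/
lemma sum_sq_sum_mul_le {α : ι → κ → ℝ} (hα : ∀ t s, 0 ≤ α t s) {S : ℝ}
    (hrow : ∀ t, ∑ s, α t s ≤ S) (hcol : ∀ s, ∑ t, α t s ≤ S) (hS : 0 ≤ S) (θ : ι → ℝ) :
    ∑ s, (∑ t, α t s * θ t) ^ 2 ≤ S ^ 2 * ∑ t, θ t ^ 2 := by
  calc ∑ s, (∑ t, α t s * θ t) ^ 2 ≤ ∑ s, S * ∑ t, α t s * θ t ^ 2 := by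
        refine Finset.sum_le_sum fun s _ => ?_
        refine (Finset.sum_sq_le_sum_mul_sum_of_sq_le_mul Finset.univ (f := fun t => α t s)
          (g := fun t => α t s * θ t ^ 2) (fun t _ => hα t s)
          (fun t _ => mul_nonneg (hα t s) (sq_nonneg _)) (fun t _ => le_of_eq (by ring))).trans ?_
        exact mul_le_mul_of_nonneg_right (hcol s)
          (Finset.sum_nonneg fun t _ => mul_nonneg (hα t s) (sq_nonneg _))
    _ = S * ∑ t, (∑ s, α t s) * θ t ^ 2 := by
        rw [← Finset.mul_sum, Finset.sum_comm]
        simp_rw [Finset.sum_mul]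
    _ ≤ S * ∑ t, S * θ t ^ 2 := by
        gcongr with t
        exact hrow t
    _ = _ := by rw [← Finset.mul_sum]; ring

end LinearAlgebra

section Delays

lemma sum_fin_ite_sub_left {T t : ℕ} (ht : t ≤ T) (g : ℕ → ℝ) :
    (∑ s : Fin T, if (s : ℕ) < t then g (t - 1 - s) else 0) = ∑ k ∈ Finset.range t, g k := by
  rw [Fin.sum_univ_eq_sum_range (fun s => if s < t then g (t - 1 - s) else 0), ← Finset.sum_filter,
    ← Finset.sum_range_reflect g]
  congr 1
  ext s
  simp only [Finset.mem_filter, Finset.mem_range]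
  omega

lemma sum_fin_ite_sub_right (N s : ℕ) (g : ℕ → ℝ) :
    (∑ t : Fin N, if s < (t : ℕ) then g (t - 1 - s) else 0) =
      ∑ k ∈ Finset.range (N - (s + 1)), g k := by
  rw [Fin.sum_univ_eq_sum_range (fun t => if s < t then g (t - 1 - s) else 0), ← Finset.sum_filter]
  have h1 : (Finset.range N).filter (fun t => s < t) = Finset.Ico (s + 1) N := by
    ext t; simp only [Finset.mem_filter, Finset.mem_range, Finset.mem_Ico]; omega
  rw [h1, Finset.sum_Ico_eq_sum_range]
  refine Finset.sum_congr rfl fun k _ => ?_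
  congr 1
  omega

end Delays

namespace LTISystem

variable {r n m : ℕ} (M : LTISystem r n m) (inCov : Matrix (Fin m) (Fin m) ℝ)

/-- The covariance of the driving noise `B uₜ + wₜ`. -/
noncomputable def driveCov : Matrix (Fin r) (Fin r) ℝ := M.procCov + M.B * inCov * M.Bᵀ

/-- The response of the state at time `t` to the driving noise at time `s`. -/
def response (t s : ℕ) : Matrix (Fin r) (Fin r) ℝ := if s < t then M.A ^ (t - 1 - s) else 0

lemma response_succ (t s : ℕ) :
    M.response (t + 1) s = M.A * M.response t s + if s = t then 1 else 0 := by
  rcases lt_trichotomy s t with h | h | h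
  · rw [response, response, if_pos (by omega), if_pos h, if_neg (by omega), add_zero, ← pow_succ']
    congr 1; omega
  · subst h; simp [response]
  · rw [response, response, if_neg (by omega), if_neg (by omega), if_neg (by omega)]; simp

variable {M inCov}

lemma posSemidef_driveCov (h : inCov.PosSemidef) : (M.driveCov inCov).PosSemidef := by
  refine M.procCov_posSemidef.add ?_
  have := h.mul_mul_conjTranspose_same M.B
  rwa [Matrix.conjTranspose_eq_transpose_of_trivial] at this

lemma inner_driveCov (c : EuclideanSpace ℝ (Fin r)) :
    ⟪c, (M.driveCov inCov).toEuclideanLin c⟫ = ⟪c, M.procCov.toEuclideanLin c⟫ +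
      ⟪M.Bᵀ.toEuclideanLin c, inCov.toEuclideanLin (M.Bᵀ.toEuclideanLin c)⟫ := by
  rw [driveCov, map_add, LinearMap.add_apply, inner_add_right, toEuclideanLin_mul_apply,
    toEuclideanLin_mul_apply, inner_toEuclideanLin_right M.B]

lemma inner_driveCov_le (c : EuclideanSpace ℝ (Fin r)) :
    ⟪c, (M.driveCov inCov).toEuclideanLin c⟫ ≤ M.psiW inCov * ‖c‖ ^ 2 := by
  calc ⟪c, (M.driveCov inCov).toEuclideanLin c⟫
      ≤ ‖c‖ * ‖(M.driveCov inCov).toEuclideanLin c‖ := real_inner_le_norm _ _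
    _ ≤ ‖c‖ * (M.psiW inCov * ‖c‖) := by
        gcongr
        refine (norm_toEuclideanLin_le_sigma_one _ c).trans ?_
        gcongr
        exact le_max_right _ _
    _ = _ := by ring

lemma inner_posDef_ge (h : inCov.PosDef) (c : EuclideanSpace ℝ (Fin m)) :
    phiU inCov * ‖c‖ ^ 2 ≤ ⟪c, inCov.toEuclideanLin c⟫ := by
  have hpos : inCov.toEuclideanLin.IsPositive :=
    Matrix.isPositive_toEuclideanLin_iff.mpr h.posSemidef
  obtain ⟨b, hb⟩ := exists_orthonormalBasis_of_isPositive hpos rfl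
  rw [real_inner_comm, inner_apply_self_eq_sum hb hpos.isSymmetric, norm_sq_eq_sum_inner_sq b,
    Finset.mul_sum]
  refine Finset.sum_le_sum fun i _ => ?_
  gcongr
  refine (min_le_right _ _).trans ?_
  have hrank : inCov.rank = m := by simpa using Matrix.rank_of_isUnit _ h.isUnit
  have hi : (i : ℕ) < m := by simpa using i.2
  rw [sigmaMin, sigma, hrank]
  exact LinearMap.singularValues_antitone _ (by omega)

lemma norm_ctrb_transpose_sq (v : EuclideanSpace ℝ (Fin r)) :
    ‖M.ctrbᵀ.toEuclideanLin v‖ ^ 2 =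
      ∑ k ∈ Finset.range r, ‖M.Bᵀ.toEuclideanLin ((M.A ^ k)ᵀ.toEuclideanLin v)‖ ^ 2 := by
  rw [← Fin.sum_univ_eq_sum_range
    (fun k => ‖M.Bᵀ.toEuclideanLin ((M.A ^ k)ᵀ.toEuclideanLin v)‖ ^ 2), EuclideanSpace.norm_sq_eq,
    Fintype.sum_prod_type]
  refine Finset.sum_congr rfl fun k _ => ?_
  rw [← toEuclideanLin_mul_apply, ← Matrix.transpose_mul, EuclideanSpace.norm_sq_eq]
  rfl

lemma ctrb_excites (hM : M.IsMinimal) (hr : 0 < r) (v : EuclideanSpace ℝ (Fin r)) :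
    M.phiR ^ 2 * ‖v‖ ^ 2 ≤
      ∑ k ∈ Finset.range r, ‖M.Bᵀ.toEuclideanLin ((M.A ^ k)ᵀ.toEuclideanLin v)‖ ^ 2 := by
  have hrange : LinearMap.range M.ctrb.toEuclideanLin = ⊤ := by
    apply Submodule.eq_top_of_finrank_eq
    rw [finrank_range_toEuclideanLin, hM.1]; simp
  have h1 := sigmaMin_mul_norm_le (K := M.ctrb) (by rw [hM.1]; exact hr) (z := v)
    (by rw [hrange]; trivial)
  have h0 : 0 ≤ M.phiR := le_min zero_le_one (sigmaMin_nonneg _)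
  rw [← norm_ctrb_transpose_sq, ← mul_pow]
  gcongr
  refine le_trans ?_ h1
  gcongr
  exact min_le_right _ _

variable (M inCov) in
/-- The law of the inputs and process noises. -/
noncomputable abbrev driveLaw (T : ℕ) :
    Measure ((Fin T → EuclideanSpace ℝ (Fin m)) × (Fin T → EuclideanSpace ℝ (Fin r))) :=
  (Measure.pi fun _ : Fin T => multivariateGaussian 0 inCov).prod
    (Measure.pi fun _ : Fin T => multivariateGaussian 0 M.procCov)

end LTISystem

namespace LTISystem

variable {r n m : ℕ} {M : LTISystem r n m} {inCov : Matrix (Fin m) (Fin m) ℝ}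

variable (M) in
/-- The state at time `t` as a linear function of the inputs and process noises. -/
noncomputable def state (T t : ℕ) :
    ((Fin T → EuclideanSpace ℝ (Fin m)) × (Fin T → EuclideanSpace ℝ (Fin r))) →L[ℝ]
      EuclideanSpace ℝ (Fin r) :=
  LinearMap.toContinuousLinearMap
    { toFun := fun ω =>
        ∑ s : Fin T, (M.response t s).toEuclideanLin (M.B.toEuclideanLin (ω.1 s) + ω.2 s)
      map_add' := fun ω ω' => by
        simp only [Prod.fst_add, Prod.snd_add, Pi.add_apply, map_add, Finset.sum_add_distrib]
        abel
      map_smul' := fun a ω => by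
        simp only [Prod.smul_fst, Prod.smul_snd, Pi.smul_apply, map_smul, ← smul_add,
          Finset.smul_sum, RingHom.id_apply] }

lemma state_apply (T t : ℕ)
    (ω : (Fin T → EuclideanSpace ℝ (Fin m)) × (Fin T → EuclideanSpace ℝ (Fin r))) :
    M.state T t ω =
      ∑ s : Fin T, (M.response t s).toEuclideanLin (M.B.toEuclideanLin (ω.1 s) + ω.2 s) :=
  rfl

lemma state_zero (T : ℕ)
    (ω : (Fin T → EuclideanSpace ℝ (Fin m)) × (Fin T → EuclideanSpace ℝ (Fin r))) :
    M.state T 0 ω = 0 := by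
  simp [state_apply, response]

lemma state_succ {T : ℕ} (t : Fin T)
    (ω : (Fin T → EuclideanSpace ℝ (Fin m)) × (Fin T → EuclideanSpace ℝ (Fin r))) :
    M.state T (t + 1) ω =
      M.A.toEuclideanLin (M.state T t ω) + M.B.toEuclideanLin (ω.1 t) + ω.2 t := by
  simp only [state_apply, response_succ, map_add, LinearMap.add_apply, toEuclideanLin_mul_apply,
    Finset.sum_add_distrib, map_sum]
  have h1 : ∀ s : Fin T, ∀ z : EuclideanSpace ℝ (Fin r),
      (if (s : ℕ) = t then (1 : Matrix (Fin r) (Fin r) ℝ) else 0).toEuclideanLin z =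
        if s = t then z else 0 := by
    intro s z
    by_cases h : s = t
    · simp [h]
    · simp [h, Fin.val_inj]
  simp only [h1, Finset.sum_ite_eq', Finset.mem_univ, if_true]
  abel

lemma integral_id_driveLaw (T : ℕ) : (M.driveLaw inCov T)[id] = 0 := by
  have hint : Integrable (fun x => x) (M.driveLaw inCov T) := IsGaussian.integrable_fun_id
  ext1
  · rw [show ∫ x, id x ∂(M.driveLaw inCov T) = ∫ x, x ∂(M.driveLaw inCov T) from rfl,
      fst_integral hint, integral_fun_fst (fun x => x)]
    simpa using integral_id_pi_multivariateGaussian inCov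
  · rw [show ∫ x, id x ∂(M.driveLaw inCov T) = ∫ x, x ∂(M.driveLaw inCov T) from rfl,
      snd_integral hint, integral_fun_snd (fun x => x)]
    simpa using integral_id_pi_multivariateGaussian M.procCov

/-- The variance of a linear functional of the driving noise. -/
lemma integral_sum_inner_drive_sq (h : inCov.PosSemidef) {T : ℕ}
    (c : Fin T → EuclideanSpace ℝ (Fin r)) :
    ∫ ω, (∑ s, ⟪c s, M.B.toEuclideanLin (ω.1 s) + ω.2 s⟫) ^ 2 ∂(M.driveLaw inCov T) =
      ∑ s, ⟪c s, (M.driveCov inCov).toEuclideanLin (c s)⟫ := by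
  set L₁ := sumInner fun s => M.Bᵀ.toEuclideanLin (c s)
  set L₂ := sumInner c
  have h1 : ∀ ω : (Fin T → EuclideanSpace ℝ (Fin m)) × (Fin T → EuclideanSpace ℝ (Fin r)),
      ∑ s, ⟪c s, M.B.toEuclideanLin (ω.1 s) + ω.2 s⟫ = (L₁.coprod L₂) ω := by
    intro ω
    simp only [ContinuousLinearMap.coprod_apply, L₁, L₂, sumInner_apply, inner_add_right,
      inner_toEuclideanLin_right, Finset.sum_add_distrib]
  simp_rw [h1]
  rw [integral_dual_sq_eq_variance _ (integral_id_driveLaw T), 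
    variance_dual_prod (IsGaussian.memLp_two_id) (IsGaussian.memLp_two_id),
    ContinuousLinearMap.coprod_comp_inl, ContinuousLinearMap.coprod_comp_inr,
    variance_sumInner h, variance_sumInner M.procCov_posSemidef, ← Finset.sum_add_distrib]
  refine Finset.sum_congr rfl fun s _ => ?_
  rw [inner_driveCov, add_comm]


/-! The quadratic form `v ↦ E ∑ₜ ⟪xₜ, v⟫²`. -/

variable (M inCov) in
/-- The expected Gram matrix `∑ₜ E xₜ xₜᵀ` of the states `x₀, …, x_T`. -/
noncomputable def gram (T : ℕ) : Matrix (Fin r) (Fin r) ℝ :=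
  ∑ t : Fin (T + 1), ∑ s : Fin T, M.response t s * M.driveCov inCov * (M.response t s)ᵀ

variable (M) in
/-- The map taking the driving noises to `(⟪xₜ, v⟫)ₜ`. -/
noncomputable def stateRow (T : ℕ) (v : EuclideanSpace ℝ (Fin r)) :
    ((Fin T → EuclideanSpace ℝ (Fin m)) × (Fin T → EuclideanSpace ℝ (Fin r))) →L[ℝ]
      EuclideanSpace ℝ (Fin (T + 1)) :=
  (rowMapAt v).comp (ContinuousLinearMap.pi fun t : Fin (T + 1) => M.state T t)

lemma stateRow_apply (T : ℕ) (v : EuclideanSpace ℝ (Fin r))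
    (ω : (Fin T → EuclideanSpace ℝ (Fin m)) × (Fin T → EuclideanSpace ℝ (Fin r))) :
    M.stateRow T v ω = rowMap (fun t : Fin (T + 1) => M.state T t ω) v :=
  rfl

lemma inner_gram (T : ℕ) (v : EuclideanSpace ℝ (Fin r)) :
    ⟪v, (M.gram inCov T).toEuclideanLin v⟫ = ∑ t : Fin (T + 1), ∑ s : Fin T,
      ⟪(M.response t s)ᵀ.toEuclideanLin v,
        (M.driveCov inCov).toEuclideanLin ((M.response t s)ᵀ.toEuclideanLin v)⟫ := by
  simp only [gram, map_sum, LinearMap.sum_apply, inner_sum, toEuclideanLin_mul_apply]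
  simp only [inner_toEuclideanLin_right (M.response _ _) v]

lemma inner_stateRow (T : ℕ) (v : EuclideanSpace ℝ (Fin r)) (θ : EuclideanSpace ℝ (Fin (T + 1)))
    (ω : (Fin T → EuclideanSpace ℝ (Fin m)) × (Fin T → EuclideanSpace ℝ (Fin r))) :
    ⟪θ, M.stateRow T v ω⟫ = ∑ s : Fin T, ⟪∑ t, θ t • (M.response t s)ᵀ.toEuclideanLin v,
      M.B.toEuclideanLin (ω.1 s) + ω.2 s⟫ := by
  rw [stateRow_apply, inner_rowMap]
  simp only [state_apply, sum_inner, Finset.mul_sum, real_inner_smul_left]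
  rw [Finset.sum_comm]
  refine Finset.sum_congr rfl fun s _ => Finset.sum_congr rfl fun t _ => ?_
  rw [← inner_toEuclideanLin_right, real_inner_comm]

lemma integral_norm_stateRow_sq (h : inCov.PosSemidef) (T : ℕ) (v : EuclideanSpace ℝ (Fin r)) :
    ∫ ω, ‖M.stateRow T v ω‖ ^ 2 ∂(M.driveLaw inCov T) =
      ⟪v, (M.gram inCov T).toEuclideanLin v⟫ := by
  rw [integral_norm_sq_eq_sum (EuclideanSpace.basisFun (Fin (T + 1)) ℝ), inner_gram]
  refine Finset.sum_congr rfl fun t _ => ?_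
  simp only [inner_stateRow]
  rw [integral_sum_inner_drive_sq h]
  refine Finset.sum_congr rfl fun s _ => ?_
  have h1 : ∑ t' : Fin (T + 1), (EuclideanSpace.basisFun (Fin (T + 1)) ℝ t) t' •
      (M.response t' s)ᵀ.toEuclideanLin v = (M.response t s)ᵀ.toEuclideanLin v := by
    rw [Finset.sum_eq_single t]
    · simp
    · intro t' _ ht'
      simp [ht']
    · simp
  rw [h1]

/-- The states excite every direction: at each time `t ≥ r` the `r` inputs before `t` suffice. -/
lemma le_inner_gram (hM : M.IsMinimal) (hr : 0 < r) (h : inCov.PosDef) {T : ℕ} (hT : 2 * r ≤ T)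
    (v : EuclideanSpace ℝ (Fin r)) :
    (T / 2 : ℝ) * (phiU inCov * M.phiR ^ 2) * ‖v‖ ^ 2 ≤
      ⟪v, (M.gram inCov T).toEuclideanLin v⟫ := by
  have hu : 0 ≤ phiU inCov := le_min zero_le_one (sigmaMin_nonneg _)
  have hnn : ∀ c, 0 ≤ ⟪c, (M.driveCov inCov).toEuclideanLin c⟫ := by
    intro c
    have := (Matrix.isPositive_toEuclideanLin_iff.mpr
      (posSemidef_driveCov (M := M) h.posSemidef)).re_inner_nonneg_right c
    simpa using this
  set f : ℕ → ℝ := fun k => ⟪(M.A ^ k)ᵀ.toEuclideanLin v,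
    (M.driveCov inCov).toEuclideanLin ((M.A ^ k)ᵀ.toEuclideanLin v)⟫ with hf
  have hfnn : ∀ k, 0 ≤ f k := fun k => hnn _
  have hfB : ∀ k, phiU inCov * ‖M.Bᵀ.toEuclideanLin ((M.A ^ k)ᵀ.toEuclideanLin v)‖ ^ 2 ≤ f k := by
    intro k
    rw [hf]
    simp only [inner_driveCov]
    refine (inner_posDef_ge h _).trans (le_add_of_nonneg_left ?_)
    have := (Matrix.isPositive_toEuclideanLin_iff.mpr
      M.procCov_posSemidef).re_inner_nonneg_right ((M.A ^ k)ᵀ.toEuclideanLin v)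
    simpa using this
  have hsum : phiU inCov * M.phiR ^ 2 * ‖v‖ ^ 2 ≤ ∑ k ∈ Finset.range r, f k := by
    calc phiU inCov * M.phiR ^ 2 * ‖v‖ ^ 2 = phiU inCov * (M.phiR ^ 2 * ‖v‖ ^ 2) := by ring
      _ ≤ phiU inCov * ∑ k ∈ Finset.range r,
          ‖M.Bᵀ.toEuclideanLin ((M.A ^ k)ᵀ.toEuclideanLin v)‖ ^ 2 := by
          gcongr
          exact ctrb_excites hM hr v
      _ ≤ _ := by
          rw [Finset.mul_sum]
          exact Finset.sum_le_sum fun k _ => hfB k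
  have hinner : ∀ t : Fin (T + 1), (∑ s : Fin T, ⟪(M.response t s)ᵀ.toEuclideanLin v,
      (M.driveCov inCov).toEuclideanLin ((M.response t s)ᵀ.toEuclideanLin v)⟫) =
      ∑ k ∈ Finset.range t, f k := by
    intro t
    rw [← sum_fin_ite_sub_left (T := T) (by omega) f]
    refine Finset.sum_congr rfl fun s _ => ?_
    rw [response]
    split_ifs <;> simp [hf]
  rw [inner_gram]
  simp only [hinner]
  rw [Fin.sum_univ_eq_sum_range (fun t => ∑ k ∈ Finset.range t, f k)]
  calc (T / 2 : ℝ) * (phiU inCov * M.phiR ^ 2) * ‖v‖ ^ 2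
      = (T / 2 : ℝ) * (phiU inCov * M.phiR ^ 2 * ‖v‖ ^ 2) := by ring
    _ ≤ ((Finset.Ico r (T + 1)).card : ℝ) * (phiU inCov * M.phiR ^ 2 * ‖v‖ ^ 2) := by
        have h1 : (T / 2 : ℝ) ≤ ((Finset.Ico r (T + 1)).card : ℝ) := by
          rw [Nat.card_Ico, Nat.cast_sub (by omega)]
          have : (2 * r : ℝ) ≤ T := by exact_mod_cast hT
          push_cast
          linarith
        gcongr
    _ = ∑ t ∈ Finset.Ico r (T + 1), phiU inCov * M.phiR ^ 2 * ‖v‖ ^ 2 := by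
        rw [Finset.sum_const, nsmul_eq_mul]
    _ ≤ ∑ t ∈ Finset.Ico r (T + 1), ∑ k ∈ Finset.range t, f k := by
        refine Finset.sum_le_sum fun t ht => hsum.trans ?_
        exact Finset.sum_le_sum_of_subset_of_nonneg
          (Finset.range_subset_range.mpr (Finset.mem_Ico.mp ht).1) fun k _ _ => hfnn k
    _ ≤ _ := by
        refine Finset.sum_le_sum_of_subset_of_nonneg (fun t ht => ?_)
          fun t _ _ => Finset.sum_nonneg fun k _ => hfnn k
        exact Finset.mem_range.mpr (Finset.mem_Ico.mp ht).2

/-- Stability bounds the total response to one disturbance. -/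
lemma sum_norm_pow_le {ψA ρA : ℝ} (hψ : 1 ≤ ψA) (hρ0 : 0 < ρA) (hρ1 : ρA < 1)
    (hA : M.IsStable ψA ρA) (N : ℕ) :
    ∑ k ∈ Finset.range N, ‖M.A ^ k‖ ≤ 2 * ψA / (1 - ρA) := by
  have h1ρ : 0 < 1 - ρA := by linarith
  have hone : ‖M.A ^ 0‖ ≤ 1 := by
    rw [pow_zero, Matrix.l2_opNorm_def]
    refine ContinuousLinearMap.opNorm_le_bound _ zero_le_one fun x => ?_
    simp
  have hgeom : ∀ N, ∑ k ∈ Finset.range N, ρA ^ k ≤ 1 / (1 - ρA) := by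
    intro N
    rw [one_div, ← tsum_geometric_of_lt_one hρ0.le hρ1]
    exact (summable_geometric_of_lt_one hρ0.le hρ1).sum_le_tsum _ fun k _ => by positivity
  have hle : 1 + ψA * (1 / (1 - ρA)) ≤ 2 * ψA / (1 - ρA) := by
    rw [show 2 * ψA / (1 - ρA) = ψA * (1 / (1 - ρA)) + ψA * (1 / (1 - ρA)) by ring]
    have : 1 ≤ 1 / (1 - ρA) := by rw [le_div_iff₀ h1ρ]; linarith
    nlinarith
  cases N with
  | zero => simp; positivity
  | succ N =>
    rw [Finset.sum_range_succ']
    calc ∑ k ∈ Finset.range N, ‖M.A ^ (k + 1)‖ + ‖M.A ^ 0‖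
        ≤ ∑ k ∈ Finset.range N, ψA * ρA ^ k + 1 := by
          gcongr with k
          exact hA k
      _ ≤ ψA * (1 / (1 - ρA)) + 1 := by
          rw [← Finset.mul_sum]
          gcongr
          exact hgeom N
      _ ≤ _ := by linarith

/-- The covariance of `(⟪xₜ, v⟫)ₜ` is bounded uniformly in the length of the trajectory. -/
lemma integral_inner_stateRow_sq_le (h : inCov.PosSemidef) {ψA ρA : ℝ} (hψ : 1 ≤ ψA)
    (hρ0 : 0 < ρA) (hρ1 : ρA < 1) (hA : M.IsStable ψA ρA) (T : ℕ)
    (v : EuclideanSpace ℝ (Fin r)) (θ : EuclideanSpace ℝ (Fin (T + 1))) :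
    ∫ ω, ⟪θ, M.stateRow T v ω⟫ ^ 2 ∂(M.driveLaw inCov T) ≤
      M.psiW inCov * (2 * ψA / (1 - ρA)) ^ 2 * ‖v‖ ^ 2 * ‖θ‖ ^ 2 := by
  have h1ρ : 0 < 1 - ρA := by linarith
  have hw : 0 ≤ M.psiW inCov := zero_le_one.trans (le_max_left _ _)
  set S := 2 * ψA / (1 - ρA) with hS
  have hS0 : 0 ≤ S := by positivity
  simp only [inner_stateRow]
  rw [integral_sum_inner_drive_sq h]
  set α : Fin (T + 1) → Fin T → ℝ := fun t s => if (s : ℕ) < t then ‖M.A ^ ((t : ℕ) - 1 - s)‖ else 0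
    with hα
  have hα0 : ∀ t s, 0 ≤ α t s := fun t s => by
    simp only [hα]; split_ifs <;> positivity
  have hresp : ∀ (t : Fin (T + 1)) (s : Fin T),
      ‖(M.response t s)ᵀ.toEuclideanLin v‖ ≤ α t s * ‖v‖ := by
    intro t s
    refine (norm_toEuclideanLin_le _ v).trans ?_
    rw [norm_transpose]
    gcongr
    simp only [hα, response]
    split_ifs <;> simp
  have hc : ∀ s : Fin T, ‖∑ t, θ t • (M.response t s)ᵀ.toEuclideanLin v‖ ≤
      (∑ t, α t s * |θ t|) * ‖v‖ := by
    intro s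
    refine (norm_sum_le _ _).trans ?_
    rw [Finset.sum_mul]
    refine Finset.sum_le_sum fun t _ => ?_
    rw [norm_smul, Real.norm_eq_abs]
    calc |θ t| * ‖(M.response t s)ᵀ.toEuclideanLin v‖ ≤ |θ t| * (α t s * ‖v‖) := by
          gcongr
          exact hresp t s
      _ = _ := by ring
  have hschur := sum_sq_sum_mul_le hα0 (S := S)
    (fun t => by
      simp only [hα]
      rw [sum_fin_ite_sub_left (by omega) (fun k => ‖M.A ^ k‖)]
      exact sum_norm_pow_le hψ hρ0 hρ1 hA _)
    (fun s => by
      simp only [hα]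
      rw [sum_fin_ite_sub_right _ _ (fun k => ‖M.A ^ k‖)]
      exact sum_norm_pow_le hψ hρ0 hρ1 hA _) hS0 (fun t => |θ t|)
  calc ∑ s : Fin T, ⟪∑ t, θ t • (M.response t s)ᵀ.toEuclideanLin v,
        (M.driveCov inCov).toEuclideanLin (∑ t, θ t • (M.response t s)ᵀ.toEuclideanLin v)⟫
      ≤ ∑ s, M.psiW inCov * ((∑ t, α t s * |θ t|) * ‖v‖) ^ 2 := by
        refine Finset.sum_le_sum fun s _ => (inner_driveCov_le _).trans ?_
        gcongr
        exact hc s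
    _ = M.psiW inCov * ‖v‖ ^ 2 * ∑ s, (∑ t, α t s * |θ t|) ^ 2 := by
        rw [Finset.mul_sum]
        exact Finset.sum_congr rfl fun s _ => by ring
    _ ≤ M.psiW inCov * ‖v‖ ^ 2 * (S ^ 2 * ∑ t, |θ t| ^ 2) := by gcongr
    _ = _ := by
        simp only [sq_abs]
        rw [EuclideanSpace.norm_sq_eq θ]
        simp only [Real.norm_eq_abs, sq_abs]
        ring

/-- With high probability the empirical Gram matrix of the states is at least half its mean. -/
lemma measureReal_exists_norm_stateRow_lt_le (hM : M.IsMinimal) (hr : 0 < r) (h : inCov.PosDef)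
    {ψA ρA : ℝ} (hψ : 1 ≤ ψA) (hρ0 : 0 < ρA) (hρ1 : ρA < 1) (hA : M.IsStable ψA ρA) {T : ℕ}
    (hT : 2 * r ≤ T) {p : ℝ}
    (hp : p * (M.psiW inCov * (2 * ψA / (1 - ρA)) ^ 2) ≤
      (T / 2 : ℝ) * (phiU inCov * M.phiR ^ 2)) :
    (M.driveLaw inCov T).real {ω | ∃ v, ‖M.stateRow T v ω‖ ^ 2 <
        (T / 4 : ℝ) * (phiU inCov * M.phiR ^ 2) * ‖v‖ ^ 2} ≤
      2 * 25 ^ r * (2 * Real.exp (-(p / 1024))) := by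
  have h1ρ : 0 < 1 - ρA := by linarith
  have hw : 0 < M.psiW inCov := zero_lt_one.trans_le (le_max_left _ _)
  set Λ := M.psiW inCov * (2 * ψA / (1 - ρA)) ^ 2 with hΛ
  have hΛ0 : 0 < Λ := by positivity
  have hT0 : (0 : ℝ) < T := by
    have : 0 < T := by omega
    exact_mod_cast this
  have hm : 0 < m := by
    by_contra hm0
    have hm0 : m = 0 := by omega
    subst hm0
    have h1 := hM.1
    have h2 := M.ctrb.rank_le_card_width
    simp at h2
    omega
  have hφu : 0 < phiU inCov := by
    refine lt_min zero_lt_one (sigmaMin_pos ?_)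
    have hrank : inCov.rank = m := by simpa using Matrix.rank_of_isUnit _ h.isUnit
    omega
  have hφR : 0 < M.phiR := lt_min zero_lt_one (sigmaMin_pos (by rw [hM.1]; exact hr))
  have hgpos : ∀ v : EuclideanSpace ℝ (Fin r), v ≠ 0 →
      0 < ⟪v, (M.gram inCov T).toEuclideanLin v⟫ := by
    intro v hv
    refine lt_of_lt_of_le ?_ (le_inner_gram hM hr h hT v)
    positivity
  have hgP : (M.gram inCov T).toEuclideanLin.IsPositive := by
    rw [Matrix.isPositive_toEuclideanLin_iff, gram]
    refine Matrix.posSemidef_sum _ fun t _ => Matrix.posSemidef_sum _ fun s _ => ?_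
    have := (posSemidef_driveCov (M := M) h.posSemidef).mul_mul_conjTranspose_same (M.response t s)
    rwa [Matrix.conjTranspose_eq_transpose_of_trivial] at this
  obtain ⟨B, hB⟩ := exists_linearEquiv_norm_sq_eq hgP (fun v hv => by
    rw [real_inner_comm]; exact hgpos v hv)
  have hB' : ∀ v, ‖B v‖ ^ 2 = ⟪v, (M.gram inCov T).toEuclideanLin v⟫ := fun v => by
    rw [hB, real_inner_comm]
  have key := measureReal_exists_abs_sub_gt_le' (M.driveLaw inCov T)
    (fun ω => rowMap (fun t : Fin (T + 1) => M.state T t ω)) B (β := 1 / 8)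
    (q := 2 * Real.exp (-(p / 1024))) (by norm_num) (by positivity) (fun v hv => by
      have hv' : 0 < ‖v‖ ^ 2 := by positivity
      have h1 := measureReal_abs_norm_sq_apply_sub_ge_le (M.driveLaw inCov T)
        (integral_id_driveLaw T) (M.stateRow T v) (Λ := Λ * ‖v‖ ^ 2)
        (p := ‖B v‖ ^ 2 / (Λ * ‖v‖ ^ 2)) (ε := 1 / 8) (by positivity)
        (fun θ => integral_inner_stateRow_sq_le h.posSemidef hψ hρ0 hρ1 hA T v θ)
        (by
          rw [integral_norm_stateRow_sq h.posSemidef, hB']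
          exact le_of_eq (by field_simp)) (by norm_num) (by norm_num)
      rw [integral_norm_stateRow_sq h.posSemidef, ← hB',
        mul_div_cancel₀ _ (by positivity : Λ * ‖v‖ ^ 2 ≠ 0)] at h1
      refine h1.trans ?_
      gcongr 2 * Real.exp (-?_)
      have h2 : p ≤ ‖B v‖ ^ 2 / (Λ * ‖v‖ ^ 2) := by
        rw [le_div_iff₀ (by positivity), hB']
        refine le_trans ?_ (le_inner_gram hM hr h hT v)
        rw [← mul_assoc]
        gcongr
      linarith)
  rw [finrank_euclideanSpace, Fintype.card_fin] at key
  refine (measureReal_mono ?_).trans key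
  rintro ω ⟨v, hv⟩
  refine ⟨v, ?_⟩
  have h3 := le_inner_gram hM hr h hT v
  rw [← hB'] at h3
  rw [stateRow_apply] at hv
  refine lt_of_lt_of_le ?_ (neg_le_abs _)
  linarith

end LTISystem

/-! ### The high-probability event -/

section Event

variable {r n m T : ℕ} {M : LTISystem r n m} {inCov : Matrix (Fin m) (Fin m) ℝ}

/-- Fubini over the states: the observation noise is independent of them, so it is nearly
orthogonal to the rows they span. -/
lemma measureReal_prod_exists_cross_gt_le {Λ p : ℝ} (hvΛ : M.obsVar ≤ Λ) (hΛ : 0 < Λ)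
    (hp : (r : ℝ) ≤ p) :
    ((M.driveLaw inCov T).prod (isotropicNoise (Fin (T + 1)) (Fin n) M.obsVar)).real
        {ω | ∃ z v, 8 * Λ * p * ‖z‖ ^ 2 * ‖M.stateRow T v ω.1‖ ^ 2 <
          ⟪rowMap ω.2 z, M.stateRow T v ω.1⟫ ^ 2} ≤
      2 * 25 ^ n * (2 * Real.exp (-(p / 16))) := by
  set ν := isotropicNoise (Fin (T + 1)) (Fin n) M.obsVar with hν
  set q : ℝ := 2 * 25 ^ n * (2 * Real.exp (-(p / 16))) with hq
  have hq0 : 0 ≤ q := by positivity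
  set S : Set (((Fin T → EuclideanSpace ℝ (Fin m)) × (Fin T → EuclideanSpace ℝ (Fin r))) ×
    (Fin (T + 1) → EuclideanSpace ℝ (Fin n))) :=
    {ω | ∃ z v, 8 * Λ * p * ‖z‖ ^ 2 * ‖M.stateRow T v ω.1‖ ^ 2 <
      ⟪rowMap ω.2 z, M.stateRow T v ω.1⟫ ^ 2} with hS
  -- `S` is a union of open sets.
  have hSm : MeasurableSet S := by
    have h1 : S = ⋃ z, ⋃ v, {ω | 8 * Λ * p * ‖z‖ ^ 2 * ‖M.stateRow T v ω.1‖ ^ 2 <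
        ⟪rowMapAt z ω.2, M.stateRow T v ω.1⟫ ^ 2} := by
      ext ω; simp [hS]
    rw [h1]
    refine (isOpen_iUnion fun z => isOpen_iUnion fun v => isOpen_lt ?_ ?_).measurableSet
    · fun_prop
    · fun_prop
  have hle : ((M.driveLaw inCov T).prod ν) S ≤ ENNReal.ofReal q := by
    rw [Measure.prod_apply hSm]
    calc ∫⁻ d, ν (Prod.mk d ⁻¹' S) ∂(M.driveLaw inCov T)
        ≤ ∫⁻ _, ENNReal.ofReal q ∂(M.driveLaw inCov T) := by
          refine lintegral_mono fun d => ?_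
          have h1 := measureReal_exists_cross_gt_le (κ := Fin n)
            (rowMap fun t : Fin (T + 1) => M.state T t d) M.obsVar_nonneg hvΛ hΛ (p := p)
            (by rwa [finrank_euclideanSpace, Fintype.card_fin])
          rw [Fintype.card_fin] at h1
          exact (ENNReal.le_ofReal_iff_toReal_le (measure_ne_top _ _) hq0).mpr h1
      _ = ENNReal.ofReal q := by simp
  exact ENNReal.toReal_le_of_le_ofReal hq0 hle

lemma obsVar_le_psiEta (hn : 0 < n) : M.obsVar ≤ M.psiEta := by
  refine le_trans ?_ (le_max_right _ _)
  have h1 := norm_toEuclideanLin_le_sigma_one M.obsCov (EuclideanSpace.single ⟨0, hn⟩ 1)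
  have h2 : M.obsCov.toEuclideanLin (EuclideanSpace.single ⟨0, hn⟩ 1) =
      M.obsVar • EuclideanSpace.single ⟨0, hn⟩ 1 := by
    rw [LTISystem.obsCov, map_smul, LinearMap.smul_apply]
    congr 1
    ext i; simp
  rw [h2, norm_smul, Real.norm_eq_abs, abs_of_nonneg M.obsVar_nonneg] at h1
  simpa using h1

/-- The states are a function of the inputs and process noises. -/
lemma IsTrajectory.eq_state {Ω : Type*} [MeasurableSpace Ω] {P : Measure Ω}
    {u : Fin T → Ω → EuclideanSpace ℝ (Fin m)} {w : Fin T → Ω → EuclideanSpace ℝ (Fin r)}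
    {η : Fin (T + 1) → Ω → EuclideanSpace ℝ (Fin n)}
    {x : Fin (T + 1) → Ω → EuclideanSpace ℝ (Fin r)}
    {y : Fin (T + 1) → Ω → EuclideanSpace ℝ (Fin n)} (h : IsTrajectory M inCov T P u w η x y)
    (ω : Ω) (t : Fin (T + 1)) :
    x t ω = M.state T t (fun s => u s ω, fun s => w s ω) := by
  induction t using Fin.induction with
  | zero => rw [h.init, Fin.val_zero, LTISystem.state_zero]
  | succ t ih =>
    rw [h.step, ih, Fin.val_succ, LTISystem.state_succ]
    rfl

lemma measureReal_preimage_le_of_hasLaw {Ω α : Type*} [MeasurableSpace Ω] [MeasurableSpace α]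
    {P : Measure Ω} [IsFiniteMeasure P] {μ : Measure α} {f : Ω → α} (hf : HasLaw f μ P)
    (s : Set α) : P.real (f ⁻¹' s) ≤ μ.real s := by
  have hμ : IsFiniteMeasure μ := by rw [← hf.map_eq]; infer_instance
  refine ENNReal.toReal_mono (measure_ne_top _ _) ?_
  rw [← hf.map_eq]
  exact Measure.le_map_apply hf.aemeasurable s

lemma hasLaw_fst_and_snd {Ω α β : Type*} [MeasurableSpace Ω] [MeasurableSpace α]
    [MeasurableSpace β] {P : Measure Ω} {μ : Measure α} {ν : Measure β} {f : Ω → α × β}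
    (hμ : IsProbabilityMeasure μ) (hν : IsProbabilityMeasure ν) (hf : HasLaw f (μ.prod ν) P) :
    HasLaw (fun ω => (f ω).1) μ P ∧ HasLaw (fun ω => (f ω).2) ν P :=
  ⟨measurePreserving_fst.hasLaw.comp hf, measurePreserving_snd.hasLaw.comp hf⟩

lemma exists_measurableSet_notMem_of_measureReal_le {Ω : Type*} [MeasurableSpace Ω] {P : Measure Ω}
    [IsProbabilityMeasure P] {δ : ℝ} {S₁ S₂ S₃ : Set Ω} (h₁ : P.real S₁ ≤ δ / 3)
    (h₂ : P.real S₂ ≤ δ / 3) (h₃ : P.real S₃ ≤ δ / 3) :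
    ∃ E, MeasurableSet E ∧ 1 - δ ≤ P.real E ∧ ∀ ω ∈ E, ω ∉ S₁ ∧ ω ∉ S₂ ∧ ω ∉ S₃ := by
  have hδ : P.real (S₁ ∪ (S₂ ∪ S₃)) ≤ δ :=
    (measureReal_union_le _ _).trans
      ((add_le_add h₁ ((measureReal_union_le _ _).trans (add_le_add h₂ h₃))).trans
        (by linarith))
  refine ⟨(toMeasurable P (S₁ ∪ (S₂ ∪ S₃)))ᶜ, (measurableSet_toMeasurable _ _).compl, ?_,
    fun ω hω => ?_⟩
  · rw [probReal_compl_eq_one_sub (measurableSet_toMeasurable _ _), measureReal_def,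
      measure_toMeasurable]
    exact sub_le_sub_left hδ 1
  · have h : ω ∉ S₁ ∪ (S₂ ∪ S₃) := fun hmem => hω (subset_toMeasurable P _ hmem)
    simpa only [Set.mem_union, not_or] using h

/-- The exponential tails beat the size of the nets. -/
lemma net_mul_exp_le {n : ℕ} (hn : 2 ≤ n) {δ : ℝ} (hδ0 : 0 < δ) (hδ1 : δ < 1 / Real.exp 1) :
    2 * 25 ^ n * (2 * Real.exp (-(7 * (n * Real.log (1 / δ))))) ≤ δ / 3 := by
  have hL : 1 ≤ Real.log (1 / δ) := by
    rw [Real.le_log_iff_exp_le (by positivity)]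
    rw [lt_div_iff₀ (Real.exp_pos 1)] at hδ1
    rw [le_div_iff₀ hδ0]
    linarith
  have hn' : (2 : ℝ) ≤ n := by exact_mod_cast hn
  set L := Real.log (1 / δ) with hLdef
  have he : (2.7 : ℝ) ≤ Real.exp 1 := by linarith [Real.exp_one_gt_d9]
  have h12 : (12 : ℝ) ≤ Real.exp (2 * (n * L)) := by
    calc (12 : ℝ) ≤ 2.7 ^ 4 := by norm_num
      _ ≤ Real.exp 1 ^ 4 := by gcongr
      _ = Real.exp 4 := by rw [← Real.exp_nat_mul]; norm_num
      _ ≤ _ := Real.exp_le_exp.mpr (by nlinarith)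
  have h25 : (25 : ℝ) ^ n ≤ Real.exp (4 * (n * L)) := by
    calc (25 : ℝ) ^ n ≤ (2.7 ^ 4) ^ n := by gcongr; norm_num
      _ ≤ (Real.exp 1 ^ 4) ^ n := by gcongr
      _ = Real.exp (4 * n) := by
          rw [← pow_mul, ← Real.exp_nat_mul]; push_cast; ring_nf
      _ ≤ _ := Real.exp_le_exp.mpr (by nlinarith)
  have hδ : Real.exp (-(n * L)) ≤ δ := by
    have : Real.exp (-L) = δ := by rw [hLdef, ← Real.log_inv, Real.exp_log (by positivity)]; simp
    rw [← this]
    exact Real.exp_le_exp.mpr (by nlinarith)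
  have hsplit : Real.exp (-(7 * (n * L))) =
      Real.exp (-(2 * (n * L))) * Real.exp (-(4 * (n * L))) * Real.exp (-(n * L)) := by
    rw [← Real.exp_add, ← Real.exp_add]; ring_nf
  have h12' : 12 * Real.exp (-(2 * (n * L))) ≤ 1 := by
    rw [Real.exp_neg, ← div_eq_mul_inv, div_le_one (Real.exp_pos _)]; exact h12
  have h25' : 25 ^ n * Real.exp (-(4 * (n * L))) ≤ 1 := by
    rw [Real.exp_neg, ← div_eq_mul_inv, div_le_one (Real.exp_pos _)]; exact h25
  rw [hsplit]
  calc 2 * 25 ^ n * (2 * (Real.exp (-(2 * (n * L))) * Real.exp (-(4 * (n * L))) *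
        Real.exp (-(n * L))))
      = (12 * Real.exp (-(2 * (n * L)))) * (25 ^ n * Real.exp (-(4 * (n * L)))) *
        Real.exp (-(n * L)) / 3 := by ring
    _ ≤ 1 * 1 * δ / 3 := by gcongr
    _ = _ := by ring

/-- With probability at least `1 - δ` the states excite all directions, the observation noise is
nearly isotropic, and it is nearly orthogonal to the states. The constants `112 = 16 * 7` and
`7168 = 1024 * 7` make each of the three tails at most `exp (-7 ℓ)`, which pays for the nets. -/
lemma IsTrajectory.exists_event {Ω : Type*} [MeasurableSpace Ω] {P : Measure Ω}
    [IsProbabilityMeasure P]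
    {u : Fin T → Ω → EuclideanSpace ℝ (Fin m)} {w : Fin T → Ω → EuclideanSpace ℝ (Fin r)}
    {η : Fin (T + 1) → Ω → EuclideanSpace ℝ (Fin n)}
    {x : Fin (T + 1) → Ω → EuclideanSpace ℝ (Fin r)}
    {y : Fin (T + 1) → Ω → EuclideanSpace ℝ (Fin n)} (h : IsTrajectory M inCov T P u w η x y)
    (hr : 0 < r) (hrn : r < n) (hM : M.IsMinimal) (hpd : inCov.PosDef) {ψA ρA δ : ℝ}
    (hψ : 1 ≤ ψA) (hρ0 : 0 < ρA) (hρ1 : ρA < 1) (hA : M.IsStable ψA ρA) (hδ0 : 0 < δ)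
    (hδ1 : δ < 1 / Real.exp 1) {ℓ : ℝ} (hℓ : ℓ = n * Real.log (1 / δ))
    (hT1 : 112 * ℓ ≤ T) (hT2 : 2 * r ≤ T)
    (hT3 : 7168 * ℓ * (M.psiW inCov * (2 * ψA / (1 - ρA)) ^ 2) ≤
      (T / 2 : ℝ) * (phiU inCov * M.phiR ^ 2)) :
    ∃ E : Set Ω, MeasurableSet E ∧ 1 - δ ≤ P.real E ∧ ∀ ω ∈ E,
      (∀ v, (T / 4 : ℝ) * (phiU inCov * M.phiR ^ 2) * ‖v‖ ^ 2 ≤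
        ‖rowMap (fun t => x t ω) v‖ ^ 2) ∧
      (∀ z, |‖rowMap (fun t => η t ω) z‖ ^ 2 - (T + 1) * M.obsVar * ‖z‖ ^ 2| ≤
        4 * (√(112 * ℓ / (T + 1)) * (M.psiEta * (T + 1))) * ‖z‖ ^ 2) ∧
      ∀ z v, ⟪rowMap (fun t => η t ω) z, rowMap (fun t => x t ω) v⟫ ^ 2 ≤
        8 * M.psiEta * (112 * ℓ) * ‖z‖ ^ 2 * ‖rowMap (fun t => x t ω) v‖ ^ 2 := by
  have hψη : 0 < M.psiEta := zero_lt_one.trans_le (le_max_left _ _)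
  have hvη : M.obsVar ≤ M.psiEta := obsVar_le_psiEta (by omega)
  have hL : 1 ≤ Real.log (1 / δ) := by
    rw [Real.le_log_iff_exp_le (by positivity)]
    rw [lt_div_iff₀ (Real.exp_pos 1)] at hδ1
    rw [le_div_iff₀ hδ0]
    linarith
  have hn2 : (2 : ℝ) ≤ n := by exact_mod_cast (by omega : 2 ≤ n)
  have hrℓ : (r : ℝ) ≤ 112 * ℓ := by
    have : (r : ℝ) ≤ n := by exact_mod_cast hrn.le
    rw [hℓ]; nlinarith
  have hℓ0 : 0 < ℓ := by rw [hℓ]; positivity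
  have hT0 : (0 : ℝ) < T + 1 := by positivity
  have htail := net_mul_exp_le (by omega : 2 ≤ n) hδ0 hδ1
  rw [← hℓ] at htail
  have hlaw : HasLaw (fun ω => ((fun t => u t ω, fun t => w t ω), fun t => η t ω))
      ((M.driveLaw inCov T).prod (isotropicNoise (Fin (T + 1)) (Fin n) M.obsVar)) P :=
    ((measurePreserving_prodAssoc _ _ _).symm _).hasLaw.comp h.hasLaw
  obtain ⟨hlaw1, hlaw2⟩ := hasLaw_fst_and_snd (IsGaussian.toIsProbabilityMeasure _)
    (IsGaussian.toIsProbabilityMeasure _) hlaw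
  have b1 := LTISystem.measureReal_exists_norm_stateRow_lt_le hM hr hpd hψ hρ0 hρ1 hA hT2 hT3
  have hε : √(112 * ℓ / (T + 1)) ^ 2 = 112 * ℓ / (T + 1) := Real.sq_sqrt (by positivity)
  have b2 := measureReal_exists_noise_gt_le (ι := Fin (T + 1)) (κ := Fin n) M.obsVar_nonneg hvη hψη
    (Real.sqrt_nonneg (112 * ℓ / (T + 1)))
    (Real.sqrt_le_one.mpr (by rw [div_le_one hT0]; linarith))
  rw [hε] at b2
  simp only [Fintype.card_fin, Nat.cast_add, Nat.cast_one] at b2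
  have b3 := measureReal_prod_exists_cross_gt_le (M := M) (inCov := inCov) (T := T) hvη hψη hrℓ
  have c1 := (measureReal_preimage_le_of_hasLaw hlaw1 _).trans b1
  have c2 := (measureReal_preimage_le_of_hasLaw hlaw2 _).trans b2
  have c3 := (measureReal_preimage_le_of_hasLaw hlaw _).trans b3
  have d1 : 2 * 25 ^ r * (2 * Real.exp (-(7168 * ℓ / 1024))) ≤ δ / 3 := by
    refine le_trans ?_ htail
    rw [show 7168 * ℓ / 1024 = 7 * ℓ by ring]
    gcongr
    norm_num
  have d2 : 2 * 25 ^ n * (2 * Real.exp (-(112 * ℓ / (T + 1) * ((T : ℝ) + 1) / 16))) ≤ δ / 3 := by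
    rw [div_mul_cancel₀ _ hT0.ne', show 112 * ℓ / 16 = 7 * ℓ by ring]
    exact htail
  have d3 : 2 * 25 ^ n * (2 * Real.exp (-(112 * ℓ / 16))) ≤ δ / 3 := by
    rw [show 112 * ℓ / 16 = 7 * ℓ by ring]
    exact htail
  replace c1 := c1.trans d1
  replace c2 := c2.trans d2
  replace c3 := c3.trans d3
  obtain ⟨E, hEm, hEδ, hE⟩ := exists_measurableSet_notMem_of_measureReal_le c1 c2 c3
  refine ⟨E, hEm, hEδ, fun ω hω => ?_⟩
  have hωB := hE ω hω
  have hx : (fun t => x t ω) =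
      fun t : Fin (T + 1) => M.state T t (fun s => u s ω, fun s => w s ω) := by
    ext1 t; exact h.eq_state ω t
  simp only [Set.mem_preimage, Set.mem_ofPred_eq, not_exists, not_lt,
    LTISystem.stateRow_apply] at hωB
  rw [hx]
  exact ⟨hωB.1, hωB.2.1, hωB.2.2⟩

end Event

/-! ### Column space approximation on a regular realisation -/

section Algorithm

variable {r n T : ℕ} {y : Fin (T + 1) → EuclideanSpace ℝ (Fin n)}

lemma inner_dataCov (y : Fin (T + 1) → EuclideanSpace ℝ (Fin n)) (z w : EuclideanSpace ℝ (Fin n)) :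
    ⟪(dataCov y).toEuclideanLin z, w⟫ = ⟪rowMap y z, rowMap y w⟫ := by
  rw [real_inner_comm, inner_toEuclideanLin_eq_dotProduct, dataCov, Matrix.sum_mulVec,
    dotProduct_sum, PiLp.inner_apply]
  refine Finset.sum_congr rfl fun t _ => ?_
  rw [Matrix.vecMulVec_mulVec]
  simp only [PiLp.inner_apply, dotProduct, rowMap_apply, Pi.smul_apply, MulOpposite.smul_eq_mul_unop,
    MulOpposite.unop_op, RCLike.inner_apply, conj_trivial, Finset.mul_sum, Finset.sum_mul]
  rw [Finset.sum_comm]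
  refine Finset.sum_congr rfl fun i _ => Finset.sum_congr rfl fun j _ => ?_
  ring

lemma toEuclideanLin_dataCov (y : Fin (T + 1) → EuclideanSpace ℝ (Fin n)) :
    (dataCov y).toEuclideanLin = (rowMap y).adjoint ∘ₗ rowMap y := by
  refine LinearMap.ext fun z => ext_inner_right ℝ fun w => ?_
  rw [inner_dataCov, LinearMap.comp_apply, LinearMap.adjoint_inner_left]

lemma isPositive_dataCov (y : Fin (T + 1) → EuclideanSpace ℝ (Fin n)) :
    (dataCov y).toEuclideanLin.IsPositive := by
  rw [toEuclideanLin_dataCov]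
  exact LinearMap.isPositive_adjoint_comp_self _

lemma inner_dataCov_self (y : Fin (T + 1) → EuclideanSpace ℝ (Fin n))
    (z : EuclideanSpace ℝ (Fin n)) :
    ⟪(dataCov y).toEuclideanLin z, z⟫ = ‖rowMap y z‖ ^ 2 := by
  rw [inner_dataCov, real_inner_self_eq_norm_sq]

variable {C : Matrix (Fin n) (Fin r) ℝ} 
  {X : EuclideanSpace ℝ (Fin r) →ₗ[ℝ] EuclideanSpace ℝ (Fin (T + 1))}
  {N : EuclideanSpace ℝ (Fin n) →ₗ[ℝ] EuclideanSpace ℝ (Fin (T + 1))} {lam τ e γ : ℝ}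

namespace IsRegular

lemma le_singularValues_of_lt_rank (h : IsRegular C.toEuclideanLin X N lam τ e γ)
    (hY : ∀ z, rowMap y z = X (C.toEuclideanLin.adjoint z) + N z) {i : ℕ} (hi : i < C.rank) :
    lam / 2 - 2 * γ + τ - e ≤ (dataCov y).toEuclideanLin.singularValues i := by
  refine le_singularValues_of_le_inner (isPositive_dataCov y) (U := C.toEuclideanLin.range)
    (by rwa [finrank_range_toEuclideanLin]) fun z hz => ?_
  rw [inner_dataCov_self]
  exact h.le_norm_sq_of_mem_range hY hz

lemma singularValues_le (h : IsRegular C.toEuclideanLin X N lam τ e γ)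
    (hY : ∀ z, rowMap y z = X (C.toEuclideanLin.adjoint z) + N z) {i : ℕ} (hi : C.rank ≤ i)
    (hin : i < n) :
    (dataCov y).toEuclideanLin.singularValues i ≤ τ + e := by
  refine singularValues_le_of_inner_le (isPositive_dataCov y) (U := C.toEuclideanLin.rangeᗮ)
    (by simpa using hin) ?_ fun z hz => ?_
  · have h1 := Submodule.finrank_add_finrank_orthogonal C.toEuclideanLin.range
    rw [finrank_range_toEuclideanLin] at h1
    omega
  · rw [inner_dataCov_self]
    exact h.norm_sq_le_of_mem_orthogonal hY hz

lemma le_singularValues (h : IsRegular C.toEuclideanLin X N lam τ e γ)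
    (hY : ∀ z, rowMap y z = X (C.toEuclideanLin.adjoint z) + N z) {i : ℕ} (hin : i < n) :
    τ - e - γ ≤ (dataCov y).toEuclideanLin.singularValues i := by
  refine le_singularValues_of_le_inner (isPositive_dataCov y) (U := ⊤)
    (by simpa using hin) fun z _ => ?_
  rw [inner_dataCov_self]
  exact h.le_norm_sq hY z

/-- The singular values of the data covariance have one large gap, after the first `rank C`. -/
lemma rankEst_eq (h : IsRegular C.toEuclideanLin X N lam τ e γ)
    (hY : ∀ z, rowMap y z = X (C.toEuclideanLin.adjoint z) + N z) (hC : 0 < C.rank)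
    (hCn : C.rank < n) (hsmall : e + γ ≤ lam / 8)
    (hnoise : 2 * e + γ ≤ (T : ℝ) ^ (3 / 4 : ℝ)) (hsignal : (T : ℝ) ^ (3 / 4 : ℝ) < lam / 4) :
    rankEst y = C.rank := by
  have hγ := h.γ_nonneg
  refine IsGreatest.csSup_eq ⟨⟨hC, hCn, ?_⟩, ?_⟩
  · have h1 := h.le_singularValues_of_lt_rank hY (i := C.rank - 1) (by omega)
    have h2 := h.singularValues_le hY (i := C.rank) le_rfl hCn
    rw [sigma, sigma, Nat.add_sub_cancel]
    linarith
  · rintro i ⟨hi1, hin, hgap⟩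
    by_contra! hlt
    have h1 := h.singularValues_le hY (i := i - 1) (by omega) (by omega)
    have h2 := h.le_singularValues hY hin
    rw [sigma, sigma, Nat.add_sub_cancel] at hgap
    linarith

end IsRegular

lemma range_toEuclideanLin_eq_of_isColBasis {k : ℕ} {Φ : Matrix (Fin n) (Fin k) ℝ}
    (hΦ : IsColBasis C Φ) : Φ.toEuclideanLin.range = C.toEuclideanLin.range := by
  have key : ∀ {l : ℕ} (K : Matrix (Fin n) (Fin l) ℝ) (z : EuclideanSpace ℝ (Fin n)),
      z ∈ K.toEuclideanLin.range ↔ z.ofLp ∈ Submodule.span ℝ (Set.range K.col) := by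
    intro l K z
    rw [← Matrix.range_mulVecLin]
    constructor
    · rintro ⟨x, rfl⟩; exact ⟨x.ofLp, by simp⟩
    · rintro ⟨x, hx⟩; exact ⟨WithLp.toLp 2 x, by ext i; simpa using congrFun hx i⟩
  ext z
  rw [key, key, hΦ.2]

lemma norm_toEuclideanLin_of_transpose_mul_self {k : ℕ} {Φ : Matrix (Fin n) (Fin k) ℝ}
    (hΦ : Φᵀ * Φ = 1) (x : EuclideanSpace ℝ (Fin k)) : ‖Φ.toEuclideanLin x‖ = ‖x‖ := by
  have h : ‖Φ.toEuclideanLin x‖ ^ 2 = ‖x‖ ^ 2 := by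
    rw [← real_inner_self_eq_norm_sq, inner_toEuclideanLin_right, ← toEuclideanLin_mul_apply, hΦ,
      ← real_inner_self_eq_norm_sq]
    congr 1
    ext i; simp
  exact (sq_eq_sq₀ (norm_nonneg _) (norm_nonneg _)).mp h

/-- The operator norm of `Φᵀ Ψ` as the largest cosine between the column spaces. -/
lemma abs_inner_le_norm_transpose_mul {k l : ℕ} {Φ : Matrix (Fin n) (Fin k) ℝ}
    {Ψ : Matrix (Fin n) (Fin l) ℝ} (hΦ : Φᵀ * Φ = 1) (hΨ : Ψᵀ * Ψ = 1)
    {p v : EuclideanSpace ℝ (Fin n)} (hp : p ∈ Φ.toEuclideanLin.range)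
    (hv : v ∈ Ψ.toEuclideanLin.range) : |⟪p, v⟫| ≤ ‖Φᵀ * Ψ‖ * ‖p‖ * ‖v‖ := by
  obtain ⟨a, rfl⟩ := hp
  obtain ⟨b, rfl⟩ := hv
  rw [norm_toEuclideanLin_of_transpose_mul_self hΦ, norm_toEuclideanLin_of_transpose_mul_self hΨ,
    real_inner_comm, inner_toEuclideanLin_right, ← toEuclideanLin_mul_apply, real_inner_comm]
  refine (abs_real_inner_le_norm _ _).trans ?_
  have := norm_toEuclideanLin_le (Φᵀ * Ψ) b
  nlinarith [norm_nonneg a]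

lemma norm_transpose_mul_le {k l : ℕ} {Φ : Matrix (Fin n) (Fin k) ℝ}
    {Ψ : Matrix (Fin n) (Fin l) ℝ} (hΦ : Φᵀ * Φ = 1) (hΨ : Ψᵀ * Ψ = 1) {β : ℝ} (hβ : 0 ≤ β)
    (h : ∀ p ∈ Φ.toEuclideanLin.range, ∀ v ∈ Ψ.toEuclideanLin.range, |⟪p, v⟫| ≤ β * ‖p‖ * ‖v‖) :
    ‖Φᵀ * Ψ‖ ≤ β := by
  rw [Matrix.l2_opNorm_def]
  refine ContinuousLinearMap.opNorm_le_bound _ hβ fun b => ?_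
  change ‖(Φᵀ * Ψ).toEuclideanLin b‖ ≤ _
  set a := (Φᵀ * Ψ).toEuclideanLin b with ha
  have h1 := h _ ⟨a, rfl⟩ _ ⟨b, rfl⟩
  rw [norm_toEuclideanLin_of_transpose_mul_self hΦ, norm_toEuclideanLin_of_transpose_mul_self hΨ,
    real_inner_comm, inner_toEuclideanLin_right, ← toEuclideanLin_mul_apply, ← ha,
    real_inner_self_eq_norm_sq, abs_of_nonneg (sq_nonneg _)] at h1
  rcases (norm_nonneg a).eq_or_lt with h0 | h0
  · rw [← h0]; positivity
  · nlinarith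

namespace IsRegular

/-- On a regular realisation column space approximation finds the rank, and its output is close to
the column space. -/
theorem rankEst_eq_and_norm_le (h : IsRegular C.toEuclideanLin X N lam τ e γ)
    (hY : ∀ z, rowMap y z = X (C.toEuclideanLin.adjoint z) + N z) (hC : 0 < C.rank)
    (hCn : C.rank < n) (hsmall : e + γ ≤ lam / 8)
    (hnoise : 2 * e + γ ≤ (T : ℝ) ^ (3 / 4 : ℝ)) (hsignal : (T : ℝ) ^ (3 / 4 : ℝ) < lam / 4) :
    rankEst y = C.rank ∧ ∀ Φhat : Matrix (Fin n) (Fin (rankEst y)) ℝ, IsColApprox y Φhat →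
      Φhat.rank = C.rank ∧
      ∀ (k l : ℕ) (ΦC : Matrix (Fin n) (Fin k) ℝ) (Φperp : Matrix (Fin n) (Fin l) ℝ),
        IsColBasis C ΦC → IsOrthCompl Φhat Φperp →
        ‖Φperpᵀ * ΦC‖ ≤ 2 * (2 * √γ / √lam + e / lam) := by
  have hlam := h.lam_pos
  have he := h.e_nonneg
  have hγ := h.γ_nonneg
  have hr := h.rankEst_eq hY hC hCn hsmall hnoise hsignal
  refine ⟨hr, fun Φ hΦ => ⟨?_, fun k l ΦC Φp hΦC hΦp => ?_⟩⟩
  · rw [← Matrix.rank_transpose_mul_self, hΦ.1, Matrix.rank_one, Fintype.card_fin, hr]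
  obtain ⟨hcols, hrows⟩ := hΦp
  rw [Matrix.transpose_fromCols, Matrix.fromRows_mul_fromCols, ← Matrix.fromBlocks_one,
    Matrix.fromBlocks_inj] at hcols
  obtain ⟨-, hΦΦp, hΦpΦ, hΦp1⟩ := hcols
  rw [Matrix.transpose_fromCols, Matrix.fromCols_mul_fromRows] at hrows
  -- The columns of `Φ` are eigenvectors of the data covariance.
  set φ : Fin (rankEst y) → EuclideanSpace ℝ (Fin n) :=
    fun j => Φ.toEuclideanLin (EuclideanSpace.single j 1) with hφ
  have hφcol : ∀ j, (φ j).ofLp = Φ.col j := by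
    intro j
    ext i; simp [hφ]
  have hφo : Orthonormal ℝ φ := by
    rw [orthonormal_iff_ite]
    intro i j
    rw [hφ]
    simp only
    rw [inner_toEuclideanLin_right, ← toEuclideanLin_mul_apply, hΦ.1]
    simp [EuclideanSpace.inner_single_right, eq_comm]
  have hTφ : ∀ j, (dataCov y).toEuclideanLin (φ j) =
      (dataCov y).toEuclideanLin.singularValues j • φ j := by
    intro j
    have h1 := hΦ.2 j
    rw [← hφcol, sigma, Nat.add_sub_cancel] at h1
    ext i
    simpa using congrFun h1 i
  have hgap : ∀ j : Fin (rankEst y), (dataCov y).toEuclideanLin.singularValues (rankEst y) <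
      (dataCov y).toEuclideanLin.singularValues j := by
    intro j
    have h1 := h.le_singularValues_of_lt_rank hY (i := j) (hr ▸ j.2)
    have h2 := h.singularValues_le hY (i := rankEst y) hr.ge (hr ▸ hCn)
    linarith
  set W := Φp.toEuclideanLin.range with hW
  have hφW : ∀ p ∈ W, ∀ j, ⟪φ j, p⟫ = 0 := by
    rintro _ ⟨a, rfl⟩ j
    rw [hφ, inner_toEuclideanLin_right]
    simp only
    rw [← toEuclideanLin_mul_apply, hΦpΦ]
    simp
  have hWle : ∀ p ∈ W, ‖rowMap y p‖ ^ 2 ≤ (τ + e) * ‖p‖ ^ 2 := by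
    intro p hp
    rw [← inner_dataCov_self]
    refine (inner_apply_self_le_of_orthogonal_top (isPositive_dataCov y) hφo hTφ hgap
      (hφW p hp)).trans ?_
    gcongr
    exact h.singularValues_le hY hr.ge (hr ▸ hCn)
  have hWorth : ∀ p ∈ W, ∀ q ∈ Wᗮ, ⟪rowMap y p, rowMap y q⟫ = 0 := by
    intro p hp q hq
    have hq0 : Φpᵀ.toEuclideanLin q = 0 := by
      rw [hW, LinearMap.orthogonal_range, adjoint_toEuclideanLin] at hq
      exact hq
    -- `q` is a combination of the eigenvectors `φ j`.
    have hqΦ : q = Φ.toEuclideanLin (Φᵀ.toEuclideanLin q) := by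
      have h1 : (Φ * Φᵀ + Φp * Φpᵀ).toEuclideanLin q = q := by rw [hrows]; ext i; simp
      rw [map_add, LinearMap.add_apply, toEuclideanLin_mul_apply, toEuclideanLin_mul_apply, hq0,
        map_zero, add_zero] at h1
      exact h1.symm
    have hqs : q = ∑ j, (Φᵀ.toEuclideanLin q) j • φ j := by
      conv_lhs => rw [hqΦ]
      simp only [hφ, ← map_smul, ← map_sum]
      congr 1
      ext i
      simp [Pi.single_apply]
    rw [real_inner_comm, ← inner_dataCov, hqs, map_sum, sum_inner]
    refine Finset.sum_eq_zero fun j _ => ?_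
    rw [map_smul, hTφ, real_inner_smul_left, real_inner_smul_left, hφW p hp j, mul_zero, mul_zero]
  have hrange := range_toEuclideanLin_eq_of_isColBasis hΦC
  set s := ‖Φpᵀ * ΦC‖ with hs
  have hs0 : 0 ≤ s := norm_nonneg _
  have hstep : s ≤ 2 * √γ / √lam + e / lam + s / 2 := by
    refine norm_transpose_mul_le hΦp1 hΦC.1 (by positivity) fun p hp v hv => ?_
    refine h.abs_inner_le_add_half hY (by linarith) hWorth hWle hs0 (fun p hp v hv => ?_) hp
      (hrange ▸ hv)
    exact abs_inner_le_norm_transpose_mul hΦp1 hΦC.1 hp (hrange ▸ hv)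
  linarith

end IsRegular

end Algorithm

/-! ### The sample size -/

section SampleSize

/-- The conditions on the fourth root `s` of the sample size. Here `q` stands for
`ψ_η / (φ_u φ_C² φ_R²)`, `φ` for the denominator, and `a` for the root of `n log (1/δ)`; then `s ^ 3` is the threshold
`T ^ (3/4)`, the noise level `e` is of order `s ^ 2`, and the signal `lam` of order `s ^ 4`. -/
lemma conditions_of_fourth_root {q φ a s e γ lam : ℝ} (hq : 1 ≤ q) (hφ : 0 < φ) (hφ1 : φ ≤ 1)
    (hqφ : 1 ≤ q * φ) (ha : 1 ≤ a) (hs : 10 ^ 4 * (q * a) ≤ s)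
    (he : e ≤ 60 * (q * φ) * (a * s ^ 2)) (hγ : γ = 896 * (q * φ) * a ^ 2)
    (hlam : lam = s ^ 4 * φ / 4) :
    e + γ ≤ lam / 8 ∧ 2 * e + γ ≤ s ^ 3 ∧ s ^ 3 < lam / 4 ∧
      2 * (2 * √γ / √lam + e / lam) ≤ 1000 * (q * (a / s ^ 2)) := by
  have hqa : 1 ≤ q * a := one_le_mul_of_one_le_of_one_le hq ha
  have hs0 : 0 < s := by linarith
  have hs1 : 1 ≤ s := by linarith
  have he' : e ≤ φ * s ^ 3 / 100 := by
    calc e ≤ 60 * (q * φ) * (a * s ^ 2) := he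
      _ = 60 * (φ * s ^ 2) * (q * a) := by ring
      _ ≤ 60 * (φ * s ^ 2) * (s / 10 ^ 4) := by gcongr; linarith
      _ ≤ φ * s ^ 3 / 100 := by
        have : 0 < φ * s ^ 3 := by positivity
        nlinarith
  have hγ' : γ ≤ φ * s ^ 2 / 100 := by
    have h1 : q * a ^ 2 ≤ (q * a) ^ 2 := by
      rw [mul_pow]; gcongr; nlinarith
    have h2 : (q * a) ^ 2 ≤ (s / 10 ^ 4) ^ 2 := by gcongr; linarith
    calc γ = 896 * φ * (q * a ^ 2) := by rw [hγ]; ring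
      _ ≤ 896 * φ * (s / 10 ^ 4) ^ 2 := by gcongr; exact h1.trans h2
      _ ≤ φ * s ^ 2 / 100 := by
        have : 0 < φ * s ^ 2 := by positivity
        nlinarith
  have h23 : φ * s ^ 2 ≤ φ * s ^ 3 := by gcongr; norm_num
  have h34 : φ * s ^ 3 ≤ φ * s ^ 4 := by gcongr; norm_num
  have hφs : φ * s ^ 3 ≤ s ^ 3 := mul_le_of_le_one_left (by positivity) hφ1
  have hs3 : 0 < s ^ 3 := by positivity
  refine ⟨?_, ?_, ?_, ?_⟩
  · have : 0 < φ * s ^ 4 := by positivity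
    rw [hlam]; nlinarith
  · linarith
  · have h1 : 16 < s * φ := by
      calc (16 : ℝ) < 10 ^ 4 * ((q * φ) * 1) := by linarith
        _ ≤ 10 ^ 4 * ((q * φ) * a) := by gcongr
        _ = 10 ^ 4 * (q * a) * φ := by ring
        _ ≤ s * φ := by gcongr
    rw [hlam]
    nlinarith
  · have h1 : √γ / √lam ≤ 60 * (q * (a / s ^ 2)) := by
      rw [← Real.sqrt_div' _ (by rw [hlam]; positivity)]
      refine Real.sqrt_le_iff.mpr ⟨by positivity, ?_⟩
      rw [hγ, hlam, div_le_iff₀ (by positivity)]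
      have h2 : (60 * (q * (a / s ^ 2))) ^ 2 * (s ^ 4 * φ / 4) = 900 * (q * φ) * a ^ 2 * q := by
        field_simp; ring
      rw [h2]
      have h3 : 0 < q * φ * a ^ 2 := by positivity
      nlinarith
    have h2 : e / lam ≤ 240 * (q * (a / s ^ 2)) := by
      rw [hlam, div_le_iff₀ (by positivity)]
      refine he.trans (le_of_eq ?_)
      field_simp
      norm_num
    have h3 : 0 ≤ q * (a / s ^ 2) := by positivity
    rw [mul_div_assoc]
    linarith

lemma two_mul_div_one_sub_sq_le {ψ ρ : ℝ} (hρ0 : 0 < ρ) (hρ1 : ρ < 1) :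
    (2 * ψ / (1 - ρ)) ^ 2 ≤ 16 * ψ ^ 2 / (1 - ρ ^ 2) ^ 2 := by
  have h1 : 0 < 1 - ρ := by linarith
  have h2 : 0 < 1 - ρ ^ 2 := by nlinarith
  rw [div_pow, div_le_div_iff₀ (by positivity) (by positivity)]
  have h3 : (1 - ρ ^ 2) ^ 2 ≤ 4 * (1 - ρ) ^ 2 := by
    have : (1 - ρ ^ 2) = (1 - ρ) * (1 + ρ) := by ring
    rw [this, mul_pow]
    have : (1 + ρ) ^ 2 ≤ 4 := by nlinarith
    nlinarith [sq_nonneg (1 - ρ)]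
  nlinarith [sq_nonneg ψ]

end SampleSize

section Constants

variable {r n m : ℕ} {M : LTISystem r n m} {inCov : Matrix (Fin m) (Fin m) ℝ}

lemma LTISystem.IsMinimal.rank_pos (h : M.IsMinimal) (hr : 0 < r) : 0 < M.C.rank := by
  by_contra! h0
  have hC : M.C = 0 := by
    have h1 : M.C.toEuclideanLin.range = ⊥ := by
      rw [← Submodule.finrank_eq_zero (R := ℝ), finrank_range_toEuclideanLin]
      omega
    exact (LinearEquiv.map_eq_zero_iff _).mp (LinearMap.range_eq_bot.mp h1)
  have h1 : M.obsv = 0 := by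
    ext p j; simp [LTISystem.obsv, hC]
  have h2 := h.2
  rw [h1, Matrix.rank_zero] at h2
  omega

lemma LTISystem.IsMinimal.phiR_pos (h : M.IsMinimal) (hr : 0 < r) : 0 < M.phiR :=
  lt_min one_pos (sigmaMin_pos (by rw [h.1]; exact hr))

lemma LTISystem.IsMinimal.phiU_pos (h : M.IsMinimal) (hr : 0 < r) (hpd : inCov.PosDef) :
    0 < phiU inCov := by
  have hm : 0 < m := by
    by_contra! h0
    obtain rfl : m = 0 := by omega
    have h1 := M.ctrb.rank_le_card_width
    rw [h.1, Fintype.card_prod, Fintype.card_fin, Fintype.card_fin] at h1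
    omega
  refine lt_min one_pos (sigmaMin_pos ?_)
  rw [Matrix.rank_of_isUnit _ hpd.isUnit, Fintype.card_fin]
  exact hm

lemma LTISystem.IsMinimal.phiC_pos (h : M.IsMinimal) (hr : 0 < r) : 0 < M.phiC :=
  lt_min one_pos (sigmaMin_pos (h.rank_pos hr))

/-- The part of `κ₅` that the argument uses: the remaining factors are at least `1`. -/
lemma le_kappa5 (hM : M.IsMinimal) (hr : 0 < r) (hpd : inCov.PosDef) {ψA ρA δ : ℝ} (hψ : 1 ≤ ψA)
    (hρ0 : 0 < ρA) (hρ1 : ρA < 1) (hδ0 : 0 < δ) (hδ1 : 1 ≤ Real.log (1 / δ)) :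
    (M.psiEta / (phiU inCov * M.phiC ^ 2 * M.phiR ^ 2)) ^ 4 *
        (M.psiW inCov * ψA ^ 2 / (1 - ρA ^ 2)) ^ 2 * Real.log (1 / δ) ^ 2 ≤
      kappa5 M inCov ψA ρA δ := by
  have hU := hM.phiU_pos hr hpd
  have hC := hM.phiC_pos hr
  have hR := hM.phiR_pos hr
  have hD : 0 < 1 - ρA ^ 2 := by nlinarith
  have hψη : 1 ≤ M.psiEta := le_max_left _ _
  have hψC : 1 ≤ M.psiC := le_max_left _ _
  have hψw : 1 ≤ M.psiW inCov := le_max_left _ _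
  have hlog : Real.log (1 / δ) ≤ Real.log (r / δ) := by
    refine Real.log_le_log (by positivity) ?_
    gcongr
    exact_mod_cast hr
  have h1 : Real.log (1 / δ) ^ 2 ≤ Real.log (r / δ) ^ 4 :=
    calc Real.log (1 / δ) ^ 2 ≤ Real.log (r / δ) ^ 2 := by gcongr
      _ ≤ Real.log (r / δ) ^ 4 := by gcongr <;> linarith
  rw [kappa5]
  set mx := max 1 (Real.log (M.psiC ^ 2 * M.psiW inCov * ψA ^ 4 / (1 - ρA ^ 2) *
      ((r : ℝ) * Real.log (r / δ)))) with hmx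
  have h2 : 1 ≤ mx ^ 2 := one_le_pow₀ (le_max_left _ _)
  have h3 : (M.psiEta / (phiU inCov * M.phiC ^ 2 * M.phiR ^ 2)) ^ 4 *
        (M.psiW inCov * ψA ^ 2 / (1 - ρA ^ 2)) ^ 2 * 1 ≤
      (M.psiEta / (phiU inCov * M.phiC ^ 2 * M.phiR ^ 2)) ^ 4 *
        (M.psiW inCov * ψA ^ 2 / (1 - ρA ^ 2)) ^ 2 * M.psiC ^ 4 := by
    gcongr
    exact one_le_pow₀ hψC
  calc _ = (M.psiEta / (phiU inCov * M.phiC ^ 2 * M.phiR ^ 2)) ^ 4 *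
        (M.psiW inCov * ψA ^ 2 / (1 - ρA ^ 2)) ^ 2 * 1 * 1 * Real.log (1 / δ) ^ 2 := by ring
    _ ≤ (M.psiEta / (phiU inCov * M.phiC ^ 2 * M.phiR ^ 2)) ^ 4 *
        (M.psiW inCov * ψA ^ 2 / (1 - ρA ^ 2)) ^ 2 * M.psiC ^ 4 * mx ^ 2 *
        Real.log (r / δ) ^ 4 := by gcongr
    _ = _ := by field_simp

/-- A sample size of the order of `κ₅ n² r³` meets every requirement of the argument. -/
lemma sample_size_conditions {T : ℕ} (hM : M.IsMinimal) (hr : 0 < r) (hrn : r < n)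
    (hpd : inCov.PosDef) {ψA ρA δ : ℝ} (hψ : 1 ≤ ψA) (hρ0 : 0 < ρA) (hρ1 : ρA < 1) (hδ0 : 0 < δ)
    (hL : 1 ≤ Real.log (1 / δ)) {ℓ : ℝ} (hℓ : ℓ = n * Real.log (1 / δ))
    (hT : 10 ^ 16 * kappa5 M inCov ψA ρA δ * ((n : ℝ) ^ 2 * (r : ℝ) ^ 3) ≤ T) :
    112 * ℓ ≤ T ∧ 2 * r ≤ T ∧
      7168 * ℓ * (M.psiW inCov * (2 * ψA / (1 - ρA)) ^ 2) ≤
        (T / 2 : ℝ) * (phiU inCov * M.phiR ^ 2) ∧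
      10 ^ 16 * ((M.psiEta / (phiU inCov * M.phiC ^ 2 * M.phiR ^ 2)) ^ 4 * ℓ ^ 2) ≤ T := by
  have hU := hM.phiU_pos hr hpd
  have hC := hM.phiC_pos hr
  have hR := hM.phiR_pos hr
  have hU1 : phiU inCov ≤ 1 := min_le_left _ _
  have hC1 : M.phiC ≤ 1 := min_le_left _ _
  have hR1 : M.phiR ≤ 1 := min_le_left _ _
  have hD : 0 < 1 - ρA ^ 2 := by nlinarith
  have hD1 : 1 - ρA ^ 2 ≤ 1 := by nlinarith
  have hψη : 1 ≤ M.psiEta := le_max_left _ _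
  have hψw : 1 ≤ M.psiW inCov := le_max_left _ _
  have hr1 : (1 : ℝ) ≤ r := by exact_mod_cast hr
  have hn1 : (1 : ℝ) ≤ n := by exact_mod_cast (by omega : 1 ≤ n)
  have hκ := le_kappa5 hM hr hpd hψ hρ0 hρ1 hδ0 hL
  set φ := phiU inCov * M.phiC ^ 2 * M.phiR ^ 2 with hφ
  set q := M.psiEta / φ with hq
  set g := M.psiW inCov * ψA ^ 2 / (1 - ρA ^ 2) with hg
  set L := Real.log (1 / δ) with hLdef
  have hφ0 : 0 < φ := by positivity
  have hφle : φ ≤ phiU inCov * M.phiR ^ 2 := by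
    rw [hφ, mul_right_comm]
    exact mul_le_of_le_one_right (by positivity) (pow_le_one₀ hC.le hC1)
  have hφ1 : φ ≤ 1 := hφle.trans (mul_le_one₀ hU1 (by positivity) (pow_le_one₀ hR.le hR1))
  have hqφ : 1 ≤ q * φ := by rw [hq, div_mul_cancel₀ _ hφ0.ne']; exact hψη
  have hq1 : 1 ≤ q := by
    rw [hq, one_le_div hφ0]; exact hφ1.trans hψη
  have hψA2 : 1 ≤ ψA ^ 2 := one_le_pow₀ hψ
  have hg1 : 1 ≤ g := by
    rw [hg, one_le_div hD]
    exact hD1.trans (one_le_mul_of_one_le_of_one_le hψw hψA2)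
  have hℓ1 : 1 ≤ ℓ := by rw [hℓ]; exact one_le_mul_of_one_le_of_one_le hn1 hL
  have hr3 : (r : ℝ) ≤ (r : ℝ) ^ 3 := le_self_pow₀ hr1 (by norm_num)
  have hκ0 : 0 ≤ kappa5 M inCov ψA ρA δ := le_trans (by positivity) hκ
  have hT' : 10 ^ 16 * (q ^ 4 * g ^ 2 * ℓ ^ 2 * r) ≤ T := by
    refine le_trans ?_ hT
    calc 10 ^ 16 * (q ^ 4 * g ^ 2 * ℓ ^ 2 * r)
        = 10 ^ 16 * (q ^ 4 * g ^ 2 * L ^ 2) * ((n : ℝ) ^ 2 * r) := by rw [hℓ]; ring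
      _ ≤ _ := by gcongr
  have hq4 : 1 ≤ q ^ 4 := one_le_pow₀ hq1
  have hg2 : 1 ≤ g ^ 2 := one_le_pow₀ hg1
  have hℓ2 : ℓ ≤ ℓ ^ 2 := le_self_pow₀ hℓ1 (by norm_num)
  have hℓ2' : 1 ≤ ℓ ^ 2 := hℓ1.trans hℓ2
  refine ⟨?_, ?_, ?_, ?_⟩
  · refine le_trans ?_ hT'
    calc 112 * ℓ ≤ 10 ^ 16 * (1 * 1 * ℓ * 1) := by linarith
      _ ≤ _ := by gcongr
  · have : (2 * r : ℝ) ≤ T := by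
      refine le_trans ?_ hT'
      calc (2 * r : ℝ) ≤ 10 ^ 16 * (1 * 1 * 1 * r) := by linarith
        _ ≤ _ := by gcongr
    exact_mod_cast this
  · have h1 : M.psiW inCov * (2 * ψA / (1 - ρA)) ^ 2 ≤ 16 * g ^ 2 := by
      calc M.psiW inCov * (2 * ψA / (1 - ρA)) ^ 2
          ≤ M.psiW inCov * (16 * ψA ^ 2 / (1 - ρA ^ 2) ^ 2) := by
            gcongr; exact two_mul_div_one_sub_sq_le hρ0 hρ1
        _ = 16 * (1 * (M.psiW inCov * ψA ^ 2 / (1 - ρA ^ 2) ^ 2)) := by ring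
        _ ≤ 16 * ((M.psiW inCov * ψA ^ 2) * (M.psiW inCov * ψA ^ 2 / (1 - ρA ^ 2) ^ 2)) := by
            gcongr
            exact one_le_mul_of_one_le_of_one_le hψw hψA2
        _ = 16 * g ^ 2 := by rw [hg]; field_simp
    have h2 : 1 ≤ q ^ 4 * φ := by
      calc 1 ≤ q * φ := hqφ
        _ ≤ q ^ 4 * φ := by gcongr; exact le_self_pow₀ hq1 (by norm_num)
    calc 7168 * ℓ * (M.psiW inCov * (2 * ψA / (1 - ρA)) ^ 2) ≤ 7168 * ℓ ^ 2 * (16 * g ^ 2) := by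
          gcongr
      _ ≤ (10 ^ 16 / 2 * (g ^ 2 * ℓ ^ 2)) * 1 * 1 := by
          have : 0 < g ^ 2 * ℓ ^ 2 := by positivity
          linarith
      _ ≤ (10 ^ 16 / 2 * (g ^ 2 * ℓ ^ 2)) * (q ^ 4 * φ) * r := by gcongr
      _ = (10 ^ 16 * (q ^ 4 * g ^ 2 * ℓ ^ 2 * r)) / 2 * φ := by ring
      _ ≤ _ := by gcongr
  · refine le_trans ?_ hT'
    calc 10 ^ 16 * (q ^ 4 * ℓ ^ 2) = 10 ^ 16 * (q ^ 4 * 1 * ℓ ^ 2 * 1) := by ring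
      _ ≤ _ := by gcongr

end Constants

section Conclusion

variable {r n m T : ℕ} {M : LTISystem r n m} {inCov : Matrix (Fin m) (Fin m) ℝ}

lemma rowMap_obs {C : Matrix (Fin n) (Fin r) ℝ} {x : Fin (T + 1) → EuclideanSpace ℝ (Fin r)}
    {η y : Fin (T + 1) → EuclideanSpace ℝ (Fin n)} (h : ∀ t, y t = C.toEuclideanLin (x t) + η t)
    (z : EuclideanSpace ℝ (Fin n)) :
    rowMap y z = rowMap x (C.toEuclideanLin.adjoint z) + rowMap η z := by
  ext t
  simp only [PiLp.add_apply, rowMap_apply, h, inner_add_left, LinearMap.adjoint_inner_right]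

lemma phiC_sq_mul_norm_sq_le (hC : 0 < M.C.rank) {z : EuclideanSpace ℝ (Fin n)}
    (hz : z ∈ M.C.toEuclideanLin.range) :
    M.phiC ^ 2 * ‖z‖ ^ 2 ≤ ‖M.C.toEuclideanLin.adjoint z‖ ^ 2 := by
  have h0 : 0 ≤ M.phiC := le_min zero_le_one (sigmaMin_nonneg _)
  rw [← mul_pow, adjoint_toEuclideanLin]
  gcongr
  exact (mul_le_mul_of_nonneg_right (min_le_right _ _) (norm_nonneg z)).trans
    (sigmaMin_mul_norm_le hC hz)

end Conclusion

end ColSpace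

theorem lemma1 :
    ∃ c₁ c₂ : ℝ, 0 < c₁ ∧ 0 < c₂ ∧
      ∀ (r n m T : ℕ) (M : ColSpace.LTISystem r n m) (inCov : Matrix (Fin m) (Fin m) ℝ)
        (ψA ρA δ : ℝ) (Ω : Type*) [MeasurableSpace Ω] (P : Measure Ω) [IsProbabilityMeasure P]
        (u : Fin T → Ω → EuclideanSpace ℝ (Fin m)) (w : Fin T → Ω → EuclideanSpace ℝ (Fin r))
        (η : Fin (T + 1) → Ω → EuclideanSpace ℝ (Fin n))
        (x : Fin (T + 1) → Ω → EuclideanSpace ℝ (Fin r))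
        (y : Fin (T + 1) → Ω → EuclideanSpace ℝ (Fin n)),
        0 < r → r < n → M.IsMinimal → inCov.PosDef →
        1 ≤ ψA → 0 < ρA → ρA < 1 → M.IsStable ψA ρA →
        0 < δ → δ < 1 / Real.exp 1 →
        ColSpace.IsTrajectory M inCov T P u w η x y →
        c₁ * ColSpace.kappa5 M inCov ψA ρA δ * ((n : ℝ) ^ 2 * (r : ℝ) ^ 3) ≤ T →
        ∃ E : Set Ω, MeasurableSet E ∧ 1 - δ ≤ P.real E ∧ ∀ ω ∈ E,
          ColSpace.rankEst (fun t => y t ω) = M.C.rank ∧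
          ∀ Φhat : Matrix (Fin n) (Fin (ColSpace.rankEst fun t => y t ω)) ℝ,
            ColSpace.IsColApprox (fun t => y t ω) Φhat →
            Φhat.rank = M.C.rank ∧
            ∀ (k l : ℕ) (ΦC : Matrix (Fin n) (Fin k) ℝ) (Φperp : Matrix (Fin n) (Fin l) ℝ),
              ColSpace.IsColBasis M.C ΦC → ColSpace.IsOrthCompl Φhat Φperp →
              ‖Φperpᵀ * ΦC‖ ≤ c₂ * ColSpace.kappa4 M inCov δ * √((n : ℝ) / T) := by
  -- `10 ^ 16` makes the fourth root of `T` at least `10 ^ 4 ψ_η √(n log (1/δ)) / φ`.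
  refine ⟨10 ^ 16, 1000, by norm_num, by norm_num, ?_⟩
  intro r n m T M inCov ψA ρA δ Ω _ P _ u w η x y hr hrn hM hpd hψ hρ0 hρ1 hA hδ0 hδ1 htraj hT
  have hL : 1 ≤ Real.log (1 / δ) := by
    rw [Real.le_log_iff_exp_le (by positivity), le_div_iff₀ hδ0]
    rw [lt_div_iff₀ (Real.exp_pos 1)] at hδ1
    linarith
  obtain ⟨ℓ, hℓ⟩ : ∃ ℓ : ℝ, ℓ = n * Real.log (1 / δ) := ⟨_, rfl⟩
  obtain ⟨hT1, hT2, hT3, hT4⟩ :=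
    ColSpace.sample_size_conditions hM hr hrn hpd hψ hρ0 hρ1 hδ0 hL hℓ hT
  obtain ⟨E, hEm, hEδ, hE⟩ :=
    htraj.exists_event hr hrn hM hpd hψ hρ0 hρ1 hA hδ0 hδ1 hℓ hT1 hT2 hT3
  refine ⟨E, hEm, hEδ, fun ω hω => ?_⟩
  obtain ⟨hsignal, hnoise, hcross⟩ := hE ω hω
  have hU := hM.phiU_pos hr hpd
  have hC := hM.phiC_pos hr
  have hR := hM.phiR_pos hr
  have hψη : 1 ≤ M.psiEta := le_max_left _ _
  have hn1 : (1 : ℝ) ≤ n := by exact_mod_cast (by omega : 1 ≤ n)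
  have hℓ1 : 1 ≤ ℓ := by rw [hℓ]; exact one_le_mul_of_one_le_of_one_le hn1 hL
  have hT0 : (1 : ℝ) ≤ T := by linarith
  have hCn : M.C.rank < n :=
    (M.C.rank_le_card_width.trans_eq (Fintype.card_fin r)).trans_lt hrn
  obtain ⟨φ, hφ⟩ : ∃ φ, φ = ColSpace.phiU inCov * M.phiC ^ 2 * M.phiR ^ 2 := ⟨_, rfl⟩
  have hφ0 : 0 < φ := by rw [hφ]; positivity
  have hφ1 : φ ≤ 1 := by
    rw [hφ]
    exact mul_le_one₀ (mul_le_one₀ (min_le_left _ _) (by positivity)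
      (pow_le_one₀ hC.le (min_le_left _ _))) (by positivity) (pow_le_one₀ hR.le (min_le_left _ _))
  obtain ⟨q, hq⟩ : ∃ q, q = M.psiEta / φ := ⟨_, rfl⟩
  have hqφ : q * φ = M.psiEta := by rw [hq, div_mul_cancel₀ _ hφ0.ne']
  have hq1 : 1 ≤ q := by rw [hq, one_le_div hφ0]; exact hφ1.trans hψη
  obtain ⟨s, hs⟩ : ∃ s : ℝ, s = (T : ℝ) ^ (1 / 4 : ℝ) := ⟨_, rfl⟩
  have hs0 : 0 < s := by rw [hs]; positivity
  have hs4 : s ^ 4 = T := by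
    rw [hs, ← Real.rpow_natCast, ← Real.rpow_mul (by positivity)]
    norm_num
  have hs3 : (T : ℝ) ^ (3 / 4 : ℝ) = s ^ 3 := by
    rw [hs, ← Real.rpow_natCast, ← Real.rpow_mul (by positivity)]
    norm_num
  have hs2 : √(T : ℝ) = s ^ 2 := by
    rw [← hs4, show s ^ 4 = (s ^ 2) ^ 2 by ring, Real.sqrt_sq (by positivity)]
  have ha1 : 1 ≤ √ℓ := by rw [Real.one_le_sqrt]; exact hℓ1
  have ha2 : √ℓ ^ 2 = ℓ := Real.sq_sqrt (by linarith)
  have hsa : 10 ^ 4 * (q * √ℓ) ≤ s := by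
    refine le_of_pow_le_pow_left₀ (n := 4) (by norm_num) hs0.le ?_
    rw [hs4]
    refine le_trans (le_of_eq ?_) hT4
    rw [← hφ, ← hq, mul_pow, mul_pow, show √ℓ ^ 4 = (√ℓ ^ 2) ^ 2 by ring, ha2]
    ring
  -- `112 ℓ / (T + 1)` is the square of the relative deviation of the noise.
  have he : 4 * (√(112 * ℓ / (T + 1)) * (M.psiEta * (T + 1))) ≤ 60 * (q * φ) * (√ℓ * s ^ 2) := by
    have h1 : √(112 * ℓ / (T + 1)) * (T + 1) ≤ 15 * (√ℓ * s ^ 2) := by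
      refine le_of_sq_le_sq ?_ (by positivity)
      rw [mul_pow, Real.sq_sqrt (by positivity), mul_pow, mul_pow, ha2, ← pow_mul, hs4]
      have h2 : 112 * ℓ / ((T : ℝ) + 1) * (T + 1) ^ 2 = 112 * ℓ * (T + 1) := by field_simp
      rw [h2]
      nlinarith
    rw [hqφ]
    calc 4 * (√(112 * ℓ / (T + 1)) * (M.psiEta * (T + 1)))
        = 4 * M.psiEta * (√(112 * ℓ / (T + 1)) * (T + 1)) := by ring
      _ ≤ 4 * M.psiEta * (15 * (√ℓ * s ^ 2)) := by gcongr
      _ = _ := by ring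
  have hγ : 8 * M.psiEta * (112 * ℓ) = 896 * (q * φ) * √ℓ ^ 2 := by rw [hqφ, ha2]; ring
  have hlam : (T / 4 : ℝ) * φ = s ^ 4 * φ / 4 := by rw [hs4]; ring
  obtain ⟨k1, k2, k3, k4⟩ := ColSpace.conditions_of_fourth_root hq1 hφ0 hφ1 (by rw [hqφ]; exact hψη)
    ha1 hsa he hγ hlam
  rw [← hs3] at k2 k3
  have hreg : ColSpace.IsRegular M.C.toEuclideanLin (ColSpace.rowMap fun t => x t ω)
      (ColSpace.rowMap fun t => η t ω) ((T / 4 : ℝ) * φ) ((T + 1) * M.obsVar)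
      (4 * (√(112 * ℓ / (T + 1)) * (M.psiEta * (T + 1)))) (8 * M.psiEta * (112 * ℓ)) := by
    refine ⟨by positivity, by positivity, by positivity, fun z hz => ?_, hnoise, hcross⟩
    refine le_trans ?_ (hsignal _)
    calc (T / 4 : ℝ) * φ * ‖z‖ ^ 2
        = (T / 4 : ℝ) * (ColSpace.phiU inCov * M.phiR ^ 2) * (M.phiC ^ 2 * ‖z‖ ^ 2) := by
          rw [hφ]; ring
      _ ≤ _ := by gcongr; exact ColSpace.phiC_sq_mul_norm_sq_le (hM.rank_pos hr) hz
  obtain ⟨hrank, hout⟩ := hreg.rankEst_eq_and_norm_le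
    (ColSpace.rowMap_obs fun t => htraj.obs t ω) (hM.rank_pos hr) hCn k1 k2 k3
  refine ⟨hrank, fun Φhat hΦ => ⟨(hout Φhat hΦ).1, fun k l ΦC Φperp h1 h2 => ?_⟩⟩
  refine ((hout Φhat hΦ).2 k l ΦC Φperp h1 h2).trans (k4.trans (le_of_eq ?_))
  rw [ColSpace.kappa4, ← hφ, ← hq, hℓ, Real.sqrt_mul' _ (by linarith),
    Real.sqrt_div' _ (by linarith), hs2]
  ring
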